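/- Let $d\ge 2$ and let $a_t=\mathrm{diag}(e^{c_1t},\dots,e^{c_dt})$, where $c_1,\dots,c_d$ are non-zero reals with $\sum_j c_j=0$ and $\max_j c_j=1$; write $a=a_1$, $J^+=\{j: c_j>0\}$ and $h_a=\sum_{j\in J^+}c_j$. Let $X\simeq \mathrm{SL}_d(\mathbb R)/\mathrm{SL}_d(\mathbb Z)$ be the space of unimodular lattices in $\mathbb R^d$, let $Y\simeq \mathrm{ASL}_d(\mathbb R)/\mathrm{ASL}_d(\mathbb Z)$ be the space of unimodular grids (translates $w+L$ of lattices $L\in X$), and let $\pi:Y\to X$ be the projection sending a grid to its underlying lattice. The flow $a_t$ acts linearly on $X$ and $Y$, and $\mathbb R^d$ acts on $Y$ by translations. $\mathcal P(Z)$ denotes the set of Borel probability measures on $Z$. *Heavy lattices.* Let $\psi_i:X\to[0,1]$ ($i\in\mathbb N$) be continuous compactly supported functions such that the sets $\psi_i^{-1}(1)$ increase with $i$ and cover $X$. For non-negative numbers $\eta_i\to0$ let $\mathcal P(X,(\eta_i))=\{\mu\in\mathcal P(X):\int\psi_i\,d\mu\ge 1-\eta_i\ \forall i\}$. For $x\in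 X$ let $\Omega(x)\subset\mathcal P(X)$ be the set of probability measures that are weak-* limits (tested against $C_0(X)$) of $\frac1{n_k}\sum_{n=0}^{n_k-1}\delta_{a^nx}$ along some strictly increasing sequence $(n_k)$ of integers, and let $\mathcal H(\eta_i)=\{x\in X:\Omega(x)\cap\mathcal P(X,(\eta_i))\neq\varnothing\}$. *Leaves and dimensions.* Let $U^+=\{u\in\mathbb R^d: u_j=0 \text{ for } j\notin J^+\}$, with the Euclidean distance $d_E$ and the quasi-distance $d_a(u,v)=\max_{j\in J^+}|u_j-v_j|^{1/c_j}$. For $y\in Y$ let $r_y$ (the fiber injectivity radius) be the largest $\rho>0$ such that $u\mapsto u+y$ is injective on the open Euclidean ball of radius $\rho$ about $0$ in $\mathbb R^d$. The injective unstable leaf at $y$ is $W_y^+=\{u+y: u\in U^+,\ |u|<r_y\}$; it carries $d_E$ and $d_a$ through this parametrization. For a quasi-distance $\mathrm d$ and a bounded set $S$ let $\underline{\dim}_{\mathrm d}S=\liminf_{\delta\to0}\frac{\log N_{\mathrm d}(S,\delta)}{\log(1/\delta)}$, where $N_{\mathrm d}(S,\delta)$ is the maximal cardinality of a $\delta$-separated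 subset of $S$; put $\underline{\dim}_a=\underline{\dim}_{d_a}$ and $\underline{\dim}_M=\underline{\dim}_{d_E}$. *Entropy.* For a countable measurable partition $\mathcal P$ of $Y$ let $H_\mu(\mathcal P|X)$ be the entropy of $\mathcal P$ relative to $\pi^{-1}(\mathcal B_X)$, $\mathcal B_X$ being the Borel $\sigma$-algebra of $X$. Let $\mathcal P^{(q)}=\bigvee_{i=0}^{q-1}a^{-i}\mathcal P$ and $h_\mu(a|X)=\sup_{\mathcal P}\inf_{q\ge1}\frac1qH_\mu(\mathcal P^{(q)}|X)$, the supremum being over countable measurable partitions with $H_\mu(\mathcal P|X)<\infty$. **Proposition.** There is a constant $D$ depending only on $d$ and $c_1,\dots,c_d$ with the following property. Let $(\psi_i)$ and $(\eta_i)$ be as above, let $x\in\mathcal H(\eta_i)$, $y\in\pi^{-1}(x)$, $\mu^0\in\Omega(x)\cap\mathcal P(X,(\eta_i))$, and let $S\subset W_y^+$ be non-empty. Then there is an $a$-invariant $\mu\in\mathcal P(Y)$ such that 1. $\pi_*\mu=\mu^0$; 2. $\mathrm{Supp}\,\mu\subset\bigcap_{s\in\mathbb Z^+}\overline{\bigcup_{t\ge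 s}a_tS}$ (with $t$ real); 3. $h_\mu(a|X)\ \ge\ \underline{\dim}_aS\ \ge\ \underline{\dim}_MS+h_a-\dim U^+$; 4. for every finite measurable partition $\mathcal P$ of $Y$, every atom $P_\infty\in\mathcal P$, every index $i$ and every $r\in(0,\frac12)$ such that * $P_\infty=\pi^{-1}(P^0_\infty)$ for some $P_\infty^0\subset X$ such that $X\smallsetminus P^0_\infty$ has compact closure and $\psi_i|_{P^0_\infty}\equiv0$, * every $d_a$-ball of radius $3r$ in $U^+$ has Euclidean diameter smaller than $r_z$ for every $z\in Y\smallsetminus P_\infty$, * for every atom $P\ne P_\infty$, any two points of $P$ in the same fiber of $\pi$ are at Euclidean distance less than $r$ in that fiber, * $\mu(\partial P)=0$ for every $P\in\mathcal P$, one has $\frac1qH_\mu(\mathcal P^{(q)}|X)\ge\underline{\dim}_aS-D\eta_i$ for all $q\ge1$. -/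

import Mathlib

open MeasureTheory Filter Topology
open scoped ENNReal Pointwise ZeroAtInfty

noncomputable section

namespace GridEntropy

/-! ### Lattices and grids -/

/-- Euclidean space `ℝ^d`. -/
abbrev E (d : ℕ) : Type := EuclideanSpace ℝ (Fin d)

/-- The group `SL_d(ℝ)`. -/
abbrev SL (d : ℕ) : Type := Matrix.SpecialLinearGroup (Fin d) ℝ

/-- The linear action of `SL_d(ℝ)` on `ℝ^d`. -/
def lin {d : ℕ} (g : SL d) : E d →ₗ[ℝ] E d := Matrix.toEuclideanLin g.1

/-- The standard lattice `ℤ^d`. -/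
def stdLattice (d : ℕ) : Submodule ℤ (E d) :=
  Submodule.span ℤ (Set.range (EuclideanSpace.basisFun (Fin d) ℝ))

/-- The lattice `g ℤ^d`. -/
def latticeOf {d : ℕ} (g : SL d) : Submodule ℤ (E d) :=
  (stdLattice d).map ((lin g).restrictScalars ℤ)

/-- The space `X` of unimodular lattices of `ℝ^d`, i.e. the `SL_d(ℝ)`-orbit of `ℤ^d`. -/
def LatticeSpace (d : ℕ) : Type := {L : Submodule ℤ (E d) // ∃ g : SL d, L = latticeOf g}

/-- The coset `w + L`. -/
def cosetOf {d : ℕ} (w : E d) (L : Submodule ℤ (E d)) : Set (E d) := {v | v - w ∈ L}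

/-- The space `Y` of unimodular grids of `ℝ^d`, i.e. of cosets `w + L` with `L` in `X`. -/
def GridSpace (d : ℕ) : Type :=
  {y : Set (E d) // ∃ (g : SL d) (w : E d), y = cosetOf w (latticeOf g)}

/-- The orbit map `g ↦ g ℤ^d`. -/
def LatticeSpace.mk {d : ℕ} (g : SL d) : LatticeSpace d := ⟨latticeOf g, g, rfl⟩

/-- The orbit map `(g, w) ↦ g ℤ^d + w` of the group `ASL_d(ℝ)`, which as a topological space is
`SL_d(ℝ) × ℝ^d`. -/
def GridSpace.mk {d : ℕ} (p : SL d × E d) : GridSpace d :=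
  ⟨cosetOf p.2 (latticeOf p.1), p.1, p.2, rfl⟩

/-- The topology of `X ≃ SL_d(ℝ) / SL_d(ℤ)`. -/
instance (d : ℕ) : TopologicalSpace (LatticeSpace d) :=
  TopologicalSpace.coinduced LatticeSpace.mk inferInstance

/-- The topology of `Y ≃ ASL_d(ℝ) / ASL_d(ℤ)`. -/
instance (d : ℕ) : TopologicalSpace (GridSpace d) :=
  TopologicalSpace.coinduced GridSpace.mk inferInstance

instance (d : ℕ) : MeasurableSpace (LatticeSpace d) := borel _
instance (d : ℕ) : BorelSpace (LatticeSpace d) := ⟨rfl⟩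
instance (d : ℕ) : MeasurableSpace (GridSpace d) := borel _
instance (d : ℕ) : BorelSpace (GridSpace d) := ⟨rfl⟩

theorem latticeOf_mul {d : ℕ} (h g : SL d) :
    (latticeOf g).map ((lin h).restrictScalars ℤ) = latticeOf (h * g) := by
  have : (lin (h * g)).restrictScalars ℤ
      = ((lin h).restrictScalars ℤ).comp ((lin g).restrictScalars ℤ) := by
    ext v : 1
    simp [lin, Matrix.toLpLin_mul_same]
  rw [latticeOf, latticeOf, this, Submodule.map_comp]

theorem image_cosetOf {d : ℕ} (h g : SL d) (w : E d) :
    lin h '' cosetOf w (latticeOf g) = cosetOf (lin h w) (latticeOf (h * g)) := by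
  ext v
  simp only [← latticeOf_mul, cosetOf, Set.mem_image, Set.mem_ofPred_eq, Submodule.mem_map]
  constructor
  · rintro ⟨u, hu, rfl⟩
    exact ⟨u - w, hu, by simp⟩
  · rintro ⟨u, hu, h'⟩
    refine ⟨u + w, by simpa using hu, ?_⟩
    have h2 : lin h u = v - lin h w := h'
    rw [map_add, h2]
    abel

theorem span_sub_cosetOf {d : ℕ} (w : E d) (L : Submodule ℤ (E d)) :
    Submodule.span ℤ (cosetOf w L - cosetOf w L) = L := by
  apply le_antisymm
  · rw [Submodule.span_le]
    rintro _ ⟨p, hp, q, hq, rfl⟩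
    have := L.sub_mem hp hq
    simpa using this
  · intro v hv
    apply Submodule.subset_span
    exact ⟨w + v, by simpa [cosetOf] using hv, w, by simp [cosetOf], by simp⟩

/-- The action of `SL_d(ℝ)` on lattices. -/
def LatticeSpace.act {d : ℕ} (h : SL d) (x : LatticeSpace d) : LatticeSpace d :=
  ⟨x.1.map ((lin h).restrictScalars ℤ), by
    obtain ⟨_, g, rfl⟩ := x
    exact ⟨h * g, latticeOf_mul h g⟩⟩

/-- The linear action of `SL_d(ℝ)` on grids. -/
def GridSpace.act {d : ℕ} (h : SL d) (y : GridSpace d) : GridSpace d :=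
  ⟨lin h '' y.1, by
    obtain ⟨_, g, w, rfl⟩ := y
    exact ⟨h * g, lin h w, image_cosetOf h g w⟩⟩

/-- The action of `U ≃ ℝ^d` on grids by translations. -/
def GridSpace.translate {d : ℕ} (u : E d) (y : GridSpace d) : GridSpace d :=
  ⟨{v | v - u ∈ y.1}, by
    obtain ⟨_, g, w, rfl⟩ := y
    exact ⟨g, u + w, by ext v; simp [cosetOf, sub_sub]⟩⟩

/-- The projection `π : Y → X`: the lattice underlying a grid, spanned by the differences of
points of the grid. -/
def proj {d : ℕ} (y : GridSpace d) : LatticeSpace d :=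
  ⟨Submodule.span ℤ (y.1 - y.1), by
    obtain ⟨_, g, w, rfl⟩ := y
    exact ⟨g, span_sub_cosetOf w _⟩⟩

/-! ### The diagonal flow -/

/-- The exponents of a diagonal flow `a_t = diag (e^{c_1 t}, …, e^{c_d t})`: nonzero, of zero sum,
normalized so that the largest one is `1`. -/
structure DiagFlow (d : ℕ) where
  /-- The exponents. -/
  c : Fin d → ℝ
  ne_zero : ∀ i, c i ≠ 0
  sum_eq_zero : ∑ i, c i = 0
  isGreatest_one : IsGreatest (Set.range c) 1

namespace DiagFlow

variable {d : ℕ} (A : DiagFlow d)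

/-- The matrix `a_t`. -/
def mat (t : ℝ) : SL d :=
  ⟨Matrix.diagonal fun i => Real.exp (A.c i * t), by
    rw [Matrix.det_diagonal, ← Real.exp_sum, ← Finset.sum_mul, A.sum_eq_zero, zero_mul,
      Real.exp_zero]⟩

/-- The flow `a_t` on `X`. -/
def flowX (t : ℝ) : LatticeSpace d → LatticeSpace d := LatticeSpace.act (A.mat t)

/-- The flow `a_t` on `Y`. -/
def flowY (t : ℝ) : GridSpace d → GridSpace d := GridSpace.act (A.mat t)

/-! ### Limit measures of orbits -/

/-- The Borel probability measures on `X` that are weak-* accumulation points (in the dual of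
`C₀(X)`) of the empirical measures `(1/T) ∑_{i < T} δ_{a^i x}`, `T → ∞`, where `a = a_1`. -/
def orbitLimits (x : LatticeSpace d) : Set (ProbabilityMeasure (LatticeSpace d)) :=
  {μ₀ | ∃ T : ℕ → ℕ, StrictMono T ∧ ∀ f : C₀(LatticeSpace d, ℝ),
    Tendsto (fun k => (1 / (T k : ℝ)) * ∑ i ∈ Finset.range (T k), f ((A.flowX 1)^[i] x)) atTop
      (𝓝 (∫ z, f z ∂(μ₀ : Measure (LatticeSpace d))))}

end DiagFlow

/-- `ψ` is a sequence of continuous compactly supported functions `X → [0, 1]` such that the sets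
`ψ_i⁻¹(1)` increase and cover `X`. -/
structure IsExhaustion {d : ℕ} (ψ : ℕ → LatticeSpace d → ℝ) : Prop where
  continuous : ∀ i, Continuous (ψ i)
  hasCompactSupport : ∀ i, HasCompactSupport (ψ i)
  nonneg : ∀ i x, 0 ≤ ψ i x
  le_one : ∀ i x, ψ i x ≤ 1
  mono : Monotone fun i => ψ i ⁻¹' {1}
  cover : ⋃ i, ψ i ⁻¹' {1} = Set.univ

/-- The set `𝒫(X, (η_i))` of probability measures with `μ(ψ_i) ≥ 1 - η_i` for all `i`. -/
def tightClass {d : ℕ} (ψ : ℕ → LatticeSpace d → ℝ) (η : ℕ → ℝ) :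
    Set (ProbabilityMeasure (LatticeSpace d)) :=
  {μ | ∀ i, 1 - η i ≤ ∫ z, ψ i z ∂(μ : Measure (LatticeSpace d))}

/-- The set `ℋ(η_i)` of lattices. -/
def DiagFlow.heavySet {d : ℕ} (A : DiagFlow d) (ψ : ℕ → LatticeSpace d → ℝ) (η : ℕ → ℝ) :
    Set (LatticeSpace d) :=
  {x | (A.orbitLimits x ∩ tightClass ψ η).Nonempty}

/-! ### Fibers, unstable leaves, distances -/

/-- The Euclidean distance of two grids in the same fiber of `π`. -/
def fiberDist {d : ℕ} (y z : GridSpace d) : ℝ :=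
  sInf {ρ | ∃ u : E d, z = y.translate u ∧ ρ = ‖u‖}

/-- The fiber injectivity radius: the maximal `ρ > 0` such that `u ↦ u + y` is injective on the
open ball of radius `ρ`. -/
def injRadius {d : ℕ} (y : GridSpace d) : ℝ :=
  sSup {ρ | 0 < ρ ∧ Set.InjOn (fun u : E d => y.translate u) (Metric.ball 0 ρ)}

namespace DiagFlow

variable {d : ℕ} (A : DiagFlow d)

/-- The unstable subspace `U⁺` of the translation group: `u_i = 0` unless `c_i > 0`. -/
def Uplus : Submodule ℝ (E d) where
  carrier := {u | ∀ i, ¬ 0 < A.c i → u i = 0}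
  add_mem' := by
    intro u v hu hv i hi
    simp [hu i hi, hv i hi]
  zero_mem' := by simp
  smul_mem' := by
    intro r u hu i hi
    simp [hu i hi]

/-- The quasi-distance `d_a(u, v) = max_{c_j > 0} |u_j - v_j|^{1/c_j}` on `U⁺`. -/
def qdist (u v : E d) : ℝ := ⨆ j : {j : Fin d // 0 < A.c j}, |u j - v j| ^ (1 / A.c j)

/-- The open ball of `U⁺` for the quasi-distance `d_a`. -/
def qball (u : E d) (ρ : ℝ) : Set (E d) := {v | v ∈ A.Uplus ∧ A.qdist u v < ρ}

/-- The ball of `U⁺` that parametrizes the injective unstable leaf at `y`. -/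
def leafBall (y : GridSpace d) : Set (E d) := {u | u ∈ A.Uplus ∧ ‖u‖ < injRadius y}

/-- The injective unstable leaf `W_y⁺` at `y` in the fiber. -/
def leaf (y : GridSpace d) : Set (GridSpace d) := (fun u => y.translate u) '' A.leafBall y

/-- `h_a`, the sum of the positive exponents. -/
def h : ℝ := ∑ j with 0 < A.c j, A.c j

end DiagFlow

/-! ### Lower Minkowski dimension -/

/-- The maximal cardinality of a `δ`-separated subset of `S`. -/
def sepNumber {α : Type*} (dist : α → α → ℝ) (S : Set α) (δ : ℝ) : ℕ∞ :=
  ⨆ T ∈ {T : Set α | T ⊆ S ∧ ∀ u ∈ T, ∀ v ∈ T, u ≠ v → δ ≤ dist u v}, T.encard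

/-- The lower Minkowski dimension of a bounded set for a quasi-distance. -/
def lowerMinkowskiDim {α : Type*} (dist : α → α → ℝ) (S : Set α) : EReal :=
  liminf (fun δ : ℝ => ENNReal.log (sepNumber dist S δ : ℝ≥0∞) / ((Real.log (1 / δ) : ℝ) : EReal))
    (𝓝[>] 0)

namespace DiagFlow

variable {d : ℕ} (A : DiagFlow d)

/-- The lower Minkowski dimension of `S ⊆ W_y⁺` for the quasi-distance `d_a`, which `W_y⁺` carries
through its parametrization by a ball of `U⁺`. -/
def dimA (y : GridSpace d) (S : Set (GridSpace d)) : EReal :=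
  lowerMinkowskiDim A.qdist {u | u ∈ A.leafBall y ∧ y.translate u ∈ S}

/-- The lower Minkowski dimension of `S ⊆ W_y⁺` for the Euclidean distance, which `W_y⁺` carries
through its parametrization by a ball of `U⁺`. -/
def dimM (y : GridSpace d) (S : Set (GridSpace d)) : EReal :=
  lowerMinkowskiDim (fun u v : E d => dist u v) {u | u ∈ A.leafBall y ∧ y.translate u ∈ S}

end DiagFlow

/-! ### Relative entropy -/

/-- A measurable partition, indexed by `ι`; atoms may be empty. -/
structure IsPartition {α ι : Type*} [MeasurableSpace α] (P : ι → Set α) : Prop where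
  measurableSet : ∀ j, MeasurableSet (P j)
  disjoint : Pairwise fun j k => Disjoint (P j) (P k)
  cover : ⋃ j, P j = Set.univ

/-- The entropy `H_μ(P | m) = ∑_j ∫ -μ(P_j | m) log μ(P_j | m) dμ` of a countable partition `P`
relative to a sub-σ-algebra `m`. -/
def relEntropy {α ι : Type*} (m : MeasurableSpace α) [MeasurableSpace α] (μ : Measure α)
    (P : ι → Set α) : ℝ≥0∞ :=
  ∑' j, ∫⁻ z, ENNReal.ofReal (Real.negMulLog ((μ[(P j).indicator (fun _ => (1 : ℝ)) | m]) z)) ∂μ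

/-- The join `P ∨ T⁻¹ P ∨ ⋯ ∨ T^{-(q-1)} P`, its atoms indexed by words of length `q`. -/
def joinIter {α ι : Type*} (T : α → α) (P : ι → Set α) (q : ℕ) : (Fin q → ι) → Set α :=
  fun w => ⋂ k : Fin q, T^[k] ⁻¹' P (w k)

/-- The relative entropy `h_μ(T | m)`: the supremum, over the countable partitions `P` with
`H_μ(P | m) < ∞`, of `inf_{q ≥ 1} (1/q) H_μ(P^{(q)} | m)`. -/
def relDynEntropy {α : Type*} (m : MeasurableSpace α) [MeasurableSpace α] (μ : Measure α)
    (T : α → α) : ℝ≥0∞ :=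
  ⨆ P ∈ {P : ℕ → Set α | IsPartition P ∧ relEntropy m μ P < ∞},
    ⨅ q ∈ {q : ℕ | 1 ≤ q}, relEntropy m μ (joinIter T P q) / (q : ℝ≥0∞)

/-- The σ-algebra `π⁻¹(𝓑_X)` on `Y`. -/
@[reducible]
def fiberAlgebra (d : ℕ) : MeasurableSpace (GridSpace d) :=
  MeasurableSpace.comap proj (inferInstance : MeasurableSpace (LatticeSpace d))

end GridEntropy

end

/-!
The measure `μ` is a weak limit of the uniform measures `μ_k` on the orbit segments `a^n (y + u)`,
`n < T_k`, `u ∈ F_k`, where `T_k` are times along which the orbit of `x` equidistributes towards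
`μ₀` and `F_k` is a largest `e^{-T_k}`-separated subset of `S` for the quasi-distance `d_a`.

*Limit.* `X` and `Y` are locally compact, second countable and Hausdorff, hence metrizable, and
`π` is proper. As `μ₀` is a probability measure, the `μ_k` are therefore tight, and Prokhorov's
theorem gives a limit along an ultrafilter (`exists_tendsto_orbitProb`). Its invariance, its
projection and its support are read off from test functions.

*Counting.* The flow multiplies `d_a` by `e^t`. Consider points of the leaf with the same itinerary
for the partition `P` that are within `d_a`-distance `3r` at time `n`. If the orbit of `x` is
outside of `P₀` at time `n`, the injectivity radius forces them to be within distance `r`, so that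
they are still within `e r < 3r` at time `n + 1`. Otherwise one splits the set into at most `3^d`
pieces with this property. Hence an atom of `⋁_{n < T_k} a^{-n} P` contains at most
`O(3^{d b})` points of `F_k`, where `b` is the number of visits of the orbit of `x` to `P₀`
(`card_le_of_itinerary`, `fiberCard_word_le`), and `b / T_k` is asymptotically at most `η_i` because
`ψ_i` vanishes on `P₀`. The constant of the theorem is thus `d log 3`.

*Entropy.* The entropy of the uniform measure on `F_k` for the long partition is therefore at least
`log |F_k| - O(1) - b d log 3`, and by subadditivity it is controlled by the entropies of the words
of length `q` (`mul_shannon_word_le`). To pass to the limit, the concave function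
`φ t = -t log t` is bounded by its tangent at `g (π z)`, where `g` is continuous, positive and close
to `μ(Q | X)`; the tangent is affine in `μ_k`, so its mean converges as soon as `μ(∂Q) = 0`
(`eventually_avg_negMulLog_le`). Together these give the lower bound for the entropy of `P`
(`mul_sub_le_sum_integral`).

*Consequences.* For each `i` there are partitions to which this bound applies
(`exists_partition`); letting `i` tend to infinity gives the bound for the dynamical entropy
(`le_relDynEntropy`). The comparison of the two dimensions (`lowerMinkowskiDim_dist_le`) is a count
of the points at mutual Euclidean distance at least `δ` in a `d_a`-ball of radius `δ`, which is a
box of sides `2 δ^{c_j}`.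
-/

noncomputable section

namespace GridEntropy

/-! ### The spaces of lattices and grids -/

section Spaces

variable {d : ℕ}

theorem lin_apply (g : SL d) (v : E d) : lin g v = WithLp.toLp 2 (g.1.mulVec v.ofLp) := by
  simp [lin, Matrix.toLpLin_apply]

@[simp] theorem lin_one (v : E d) : lin 1 v = v := by
  simp [lin_apply]

theorem lin_mul (g h : SL d) (v : E d) : lin (g * h) v = lin g (lin h v) := by
  simp [lin_apply]

@[simp] theorem lin_inv_lin (g : SL d) (v : E d) : lin g⁻¹ (lin g v) = v := by
  rw [← lin_mul, inv_mul_cancel, lin_one]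

@[simp] theorem lin_lin_inv (g : SL d) (v : E d) : lin g (lin g⁻¹ v) = v := by
  rw [← lin_mul, mul_inv_cancel, lin_one]

theorem continuous_lin : Continuous fun p : SL d × E d => lin p.1 p.2 := by
  simp_rw [lin_apply]
  refine (PiLp.continuous_toLp 2 _).comp (Continuous.matrix_mulVec ?_ ?_)
  · exact continuous_subtype_val.comp continuous_fst
  · exact (PiLp.continuous_ofLp 2 _).comp continuous_snd

theorem continuous_lin_comp {α : Type*} [TopologicalSpace α] {f : α → SL d} {g : α → E d}
    (hf : Continuous f) (hg : Continuous g) : Continuous fun x => lin (f x) (g x) :=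
  continuous_lin.comp (hf.prodMk hg)

theorem mem_stdLattice {v : E d} : v ∈ stdLattice d ↔ ∀ i, ∃ n : ℤ, (n : ℝ) = v i := by
  have := (EuclideanSpace.basisFun (Fin d) ℝ).toBasis.mem_span_iff_repr_mem ℤ v
  rw [OrthonormalBasis.coe_toBasis] at this
  rw [stdLattice, this]
  simp

theorem isClosed_stdLattice : IsClosed (stdLattice d : Set (E d)) := by
  have : (stdLattice d : Set (E d)) = ⋂ i, (fun v : E d => v i) ⁻¹' Set.range ((↑) : ℤ → ℝ) := by
    ext v
    simp [mem_stdLattice]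
  rw [this]
  exact isClosed_iInter fun i =>
    Int.isClosedEmbedding_coe_real.isClosed_range.preimage (by fun_prop)

theorem mem_latticeOf {g : SL d} {v : E d} : v ∈ latticeOf g ↔ lin g⁻¹ v ∈ stdLattice d := by
  rw [latticeOf, Submodule.mem_map]
  constructor
  · rintro ⟨u, hu, rfl⟩
    simpa using hu
  · intro h
    exact ⟨_, h, by simp⟩

theorem latticeOf_one : latticeOf (1 : SL d) = stdLattice d := by
  ext v
  simp [mem_latticeOf]

/-- Elements with the same lattice differ by an element of the stabilizer of the standard
lattice. -/
theorem latticeOf_eq_iff {g g' : SL d} :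
    latticeOf g = latticeOf g' ↔ latticeOf (g⁻¹ * g') = stdLattice d := by
  constructor
  · intro h
    rw [← latticeOf_mul, ← h, latticeOf_mul, inv_mul_cancel, latticeOf_one]
  · intro h
    have := latticeOf_mul g (g⁻¹ * g')
    rw [h, ← latticeOf_one, latticeOf_mul] at this
    simpa using this

theorem isClosed_stabilizer : IsClosed {g : SL d | latticeOf g = stdLattice d} := by
  have : {g : SL d | latticeOf g = stdLattice d} =
      ⋂ n ∈ stdLattice d, {g | lin g n ∈ stdLattice d} ∩ {g | lin g⁻¹ n ∈ stdLattice d} := by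
    ext g
    simp only [Set.mem_ofPred_eq, Set.mem_iInter, Set.mem_inter_iff]
    constructor
    · intro h n hn
      constructor
      · rw [← h, mem_latticeOf]
        simpa using hn
      · rwa [← mem_latticeOf, h]
    · intro h
      apply le_antisymm
      · intro v hv
        simpa using (h _ (mem_latticeOf.1 hv)).1
      · intro v hv
        exact mem_latticeOf.2 (h v hv).2
  rw [this]
  refine isClosed_biInter fun n _ => IsClosed.inter ?_ ?_
  · exact isClosed_stdLattice.preimage (continuous_lin_comp continuous_id continuous_const)
  · exact isClosed_stdLattice.preimage (continuous_lin_comp continuous_inv continuous_const)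

/-- The saturation of an open set is a union of its right translates by the stabilizer of the
standard lattice. -/
theorem isOpenQuotientMap_latticeMk : IsOpenQuotientMap (LatticeSpace.mk (d := d)) where
  surjective := by
    rintro ⟨_, g, rfl⟩
    exact ⟨g, rfl⟩
  continuous := continuous_coinduced_rng
  isOpenMap := by
    intro U hU
    rw [isOpen_coinduced]
    have : LatticeSpace.mk ⁻¹' (LatticeSpace.mk '' U) =
        ⋃ γ ∈ {γ : SL d | latticeOf γ = stdLattice d}, (fun g => g * γ⁻¹) ⁻¹' U := by
      ext g
      simp only [Set.mem_preimage, Set.mem_image, Set.mem_iUnion, Set.mem_ofPred_eq]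
      constructor
      · rintro ⟨u, hu, h⟩
        refine ⟨u⁻¹ * g, latticeOf_eq_iff.1 (congrArg Subtype.val h), by simpa using hu⟩
      · rintro ⟨γ, hγ, h⟩
        refine ⟨_, h, Subtype.ext (latticeOf_eq_iff.2 ?_)⟩
        simpa using hγ
    rw [this]
    exact isOpen_biUnion fun γ _ => hU.preimage (by fun_prop)

theorem gridMk_eq_iff {p q : SL d × E d} : GridSpace.mk p = GridSpace.mk q ↔
    latticeOf p.1 = latticeOf q.1 ∧ q.2 - p.2 ∈ latticeOf p.1 := by
  constructor
  · intro h
    have h1 : cosetOf p.2 (latticeOf p.1) = cosetOf q.2 (latticeOf q.1) := congrArg Subtype.val h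
    refine ⟨?_, ?_⟩
    · rw [← span_sub_cosetOf p.2 (latticeOf p.1), h1, span_sub_cosetOf]
    · have : q.2 ∈ cosetOf q.2 (latticeOf q.1) := by simp [cosetOf]
      rw [← h1] at this
      exact this
  · rintro ⟨h1, h2⟩
    apply Subtype.ext
    ext v
    simp only [GridSpace.mk, cosetOf, Set.mem_ofPred_eq, ← h1]
    rw [← sub_sub_sub_cancel_right v q.2 p.2]
    exact ((latticeOf p.1).sub_mem_iff_left h2).symm

/-- The saturation of an open set is the union of its right translates by the affine stabilizer of
the standard lattice. -/
theorem isOpenQuotientMap_gridMk : IsOpenQuotientMap (GridSpace.mk (d := d)) where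
  surjective := by
    rintro ⟨_, g, w, rfl⟩
    exact ⟨(g, w), rfl⟩
  continuous := continuous_coinduced_rng
  isOpenMap := by
    intro U hU
    rw [isOpen_coinduced]
    have : GridSpace.mk ⁻¹' (GridSpace.mk '' U) =
        ⋃ γ ∈ {γ : SL d | latticeOf γ = stdLattice d}, ⋃ n ∈ stdLattice d,
          (fun p : SL d × E d => (p.1 * γ⁻¹, p.2 - lin (p.1 * γ⁻¹) n)) ⁻¹' U := by
      ext ⟨g, w⟩
      simp only [Set.mem_preimage, Set.mem_image, Set.mem_iUnion, Set.mem_ofPred_eq]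
      constructor
      · rintro ⟨⟨u, w'⟩, hu, h⟩
        obtain ⟨h1, h2⟩ := gridMk_eq_iff.1 h
        refine ⟨u⁻¹ * g, latticeOf_eq_iff.1 h1, lin u⁻¹ (w - w'), mem_latticeOf.1 h2, ?_⟩
        simpa using hu
      · rintro ⟨γ, hγ, n, hn, h⟩
        refine ⟨_, h, gridMk_eq_iff.2 ⟨latticeOf_eq_iff.2 (by simpa using hγ), ?_⟩⟩
        rw [mem_latticeOf, sub_sub_cancel, lin_inv_lin]
        exact hn
    rw [this]
    refine isOpen_biUnion fun γ _ => isOpen_biUnion fun n _ => hU.preimage ?_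
    refine Continuous.prodMk (by fun_prop) (Continuous.sub (by fun_prop) ?_)
    exact continuous_lin_comp (by fun_prop) continuous_const

instance : LocallyCompactSpace (Matrix (Fin d) (Fin d) ℝ) :=
  inferInstanceAs (LocallyCompactSpace (Fin d → Fin d → ℝ))

instance : SecondCountableTopology (Matrix (Fin d) (Fin d) ℝ) :=
  inferInstanceAs (SecondCountableTopology (Fin d → Fin d → ℝ))

instance : LocallyCompactSpace (SL d) :=
  Matrix.SpecialLinearGroup.isClosedEmbedding_val.locallyCompactSpace

instance : SecondCountableTopology (SL d) :=
  Matrix.SpecialLinearGroup.isClosedEmbedding_val.isEmbedding.secondCountableTopology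

instance : LocallyCompactSpace (LatticeSpace d) :=
  isOpenQuotientMap_latticeMk.locallyCompactSpace

instance : LocallyCompactSpace (GridSpace d) :=
  isOpenQuotientMap_gridMk.locallyCompactSpace

instance : SecondCountableTopology (LatticeSpace d) :=
  isOpenQuotientMap_latticeMk.isQuotientMap.secondCountableTopology
    isOpenQuotientMap_latticeMk.isOpenMap

instance : SecondCountableTopology (GridSpace d) :=
  isOpenQuotientMap_gridMk.isQuotientMap.secondCountableTopology
    isOpenQuotientMap_gridMk.isOpenMap

instance : T2Space (LatticeSpace d) := by
  rw [t2Space_iff_of_isOpenQuotientMap isOpenQuotientMap_latticeMk]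
  have : {q : SL d × SL d | LatticeSpace.mk q.1 = LatticeSpace.mk q.2} =
      (fun q => q.1⁻¹ * q.2) ⁻¹' {g : SL d | latticeOf g = stdLattice d} := by
    ext q
    simp only [Set.mem_preimage, Set.mem_ofPred_eq, ← latticeOf_eq_iff]
    exact Subtype.ext_iff
  rw [this]
  exact isClosed_stabilizer.preimage (by fun_prop)

instance : T2Space (GridSpace d) := by
  rw [t2Space_iff_of_isOpenQuotientMap isOpenQuotientMap_gridMk]
  have : {q : (SL d × E d) × (SL d × E d) | GridSpace.mk q.1 = GridSpace.mk q.2} =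
      (fun q => q.1.1⁻¹ * q.2.1) ⁻¹' {g : SL d | latticeOf g = stdLattice d} ∩
      (fun q => lin q.1.1⁻¹ (q.2.2 - q.1.2)) ⁻¹' (stdLattice d) := by
    ext q
    simp only [Set.mem_preimage, Set.mem_ofPred_eq, ← latticeOf_eq_iff, gridMk_eq_iff,
      Set.mem_inter_iff, mem_latticeOf, SetLike.mem_coe]
  rw [this]
  refine (isClosed_stabilizer.preimage (by fun_prop)).inter (isClosed_stdLattice.preimage ?_)
  exact continuous_lin_comp (by fun_prop) (by fun_prop)

@[simp] theorem proj_gridMk (p : SL d × E d) : proj (GridSpace.mk p) = LatticeSpace.mk p.1 :=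
  Subtype.ext (span_sub_cosetOf _ _)

theorem continuous_proj : Continuous (proj (d := d)) := by
  rw [isOpenQuotientMap_gridMk.isQuotientMap.continuous_iff]
  have : proj ∘ GridSpace.mk = fun p : SL d × E d => LatticeSpace.mk p.1 := by
    ext p : 1
    simp
  rw [this]
  exact isOpenQuotientMap_latticeMk.continuous.comp continuous_fst

@[simp] theorem act_gridMk (h : SL d) (p : SL d × E d) :
    GridSpace.act h (GridSpace.mk p) = GridSpace.mk (h * p.1, lin h p.2) :=
  Subtype.ext (image_cosetOf _ _ _)

@[simp] theorem act_latticeMk (h g : SL d) :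
    LatticeSpace.act h (LatticeSpace.mk g) = LatticeSpace.mk (h * g) :=
  Subtype.ext (latticeOf_mul _ _)

theorem continuous_gridAct (h : SL d) : Continuous (GridSpace.act h) := by
  rw [isOpenQuotientMap_gridMk.isQuotientMap.continuous_iff]
  have : GridSpace.act h ∘ GridSpace.mk =
      GridSpace.mk ∘ fun p : SL d × E d => (h * p.1, lin h p.2) := by
    ext p : 1
    simp
  rw [this]
  refine isOpenQuotientMap_gridMk.continuous.comp (Continuous.prodMk (by fun_prop) ?_)
  exact continuous_lin_comp continuous_const continuous_snd

@[simp] theorem translate_gridMk (u : E d) (p : SL d × E d) :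
    (GridSpace.mk p).translate u = GridSpace.mk (p.1, u + p.2) := by
  apply Subtype.ext
  ext v
  simp [GridSpace.mk, GridSpace.translate, cosetOf, sub_sub]

theorem exists_gridMk (z : GridSpace d) : ∃ p, GridSpace.mk p = z :=
  isOpenQuotientMap_gridMk.surjective z

@[simp] theorem proj_translate (u : E d) (z : GridSpace d) : proj (z.translate u) = proj z := by
  obtain ⟨p, rfl⟩ := exists_gridMk z
  simp

theorem proj_act (h : SL d) (z : GridSpace d) : proj (z.act h) = (proj z).act h := by
  obtain ⟨p, rfl⟩ := exists_gridMk z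
  simp

theorem act_translate (h : SL d) (u : E d) (z : GridSpace d) :
    (z.translate u).act h = (z.act h).translate (lin h u) := by
  obtain ⟨p, rfl⟩ := exists_gridMk z
  simp

theorem act_act (h g : SL d) (z : GridSpace d) : (z.act g).act h = z.act (h * g) := by
  obtain ⟨p, rfl⟩ := exists_gridMk z
  simp [mul_assoc, lin_mul]

theorem act_one (z : GridSpace d) : z.act 1 = z := by
  obtain ⟨p, rfl⟩ := exists_gridMk z
  simp

theorem translate_translate (u v : E d) (z : GridSpace d) :
    (z.translate v).translate u = z.translate (u + v) := by
  obtain ⟨p, rfl⟩ := exists_gridMk z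
  simp [add_assoc]

/-- Grids over the same lattice are translates of each other. -/
theorem exists_translate_of_proj_eq {z z' : GridSpace d} (h : proj z = proj z') :
    ∃ u, z' = z.translate u := by
  obtain ⟨p, rfl⟩ := exists_gridMk z
  obtain ⟨q, rfl⟩ := exists_gridMk z'
  refine ⟨q.2 - p.2, ?_⟩
  rw [translate_gridMk, sub_add_cancel, gridMk_eq_iff]
  refine ⟨?_, by simp⟩
  rw [proj_gridMk, proj_gridMk] at h
  exact (congrArg Subtype.val h).symm

/-- A compact set of lattices lifts to a compact set of matrices. -/
theorem exists_compact_lift {K : Set (LatticeSpace d)} (hK : IsCompact K) :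
    ∃ C : Set (SL d), IsCompact C ∧ K ⊆ LatticeSpace.mk '' C := by
  have h (x : LatticeSpace d) : ∃ C : Set (SL d), IsCompact C ∧ LatticeSpace.mk '' C ∈ 𝓝 x := by
    obtain ⟨g, rfl⟩ := isOpenQuotientMap_latticeMk.surjective x
    obtain ⟨C, hC, hg⟩ := exists_compact_mem_nhds g
    exact ⟨C, hC, isOpenQuotientMap_latticeMk.isOpenMap.image_mem_nhds hg⟩
  choose C hC hx using h
  obtain ⟨t, -, ht⟩ := hK.elim_nhds_subcover (fun x => LatticeSpace.mk '' C x) fun x _ => hx x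
  refine ⟨⋃ x ∈ t, C x, t.isCompact_biUnion fun x _ => hC x, ?_⟩
  simpa [Set.image_iUnion] using ht

/-- The projection of grids to lattices is proper: its fibers are tori. -/
theorem isCompact_preimage_proj {K : Set (LatticeSpace d)} (hK : IsCompact K) :
    IsCompact (proj ⁻¹' K) := by
  obtain ⟨C, hC, hCK⟩ := exists_compact_lift hK
  -- every grid over `g ℤ^d` has an offset in the parallelotope `g [0, 1]^d`
  set B : Set (E d) := WithLp.ofLp ⁻¹' Set.Icc 0 1
  have hB : IsCompact B := by
    have := (isCompact_Icc (a := (0 : Fin d → ℝ)) (b := 1)).image (PiLp.continuous_toLp 2 _)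
    convert this using 1
    ext v
    constructor
    · intro hv
      exact ⟨v.ofLp, hv, rfl⟩
    · rintro ⟨w, hw, rfl⟩
      exact hw
  have hcomp : IsCompact (GridSpace.mk '' ((fun p : SL d × E d => (p.1, lin p.1 p.2)) '' C ×ˢ B)) :=
    ((hC.prod hB).image (continuous_fst.prodMk continuous_lin)).image
      isOpenQuotientMap_gridMk.continuous
  refine hcomp.of_isClosed_subset (hK.isClosed.preimage continuous_proj) ?_
  intro z hz
  obtain ⟨⟨g, w⟩, rfl⟩ := exists_gridMk z
  simp only [Set.mem_preimage, proj_gridMk] at hz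
  obtain ⟨g', hg', h⟩ := hCK hz
  refine ⟨_, ⟨(g', WithLp.toLp 2 fun i => Int.fract (lin g'⁻¹ w i)), ⟨hg', ?_⟩, rfl⟩, ?_⟩
  · exact ⟨fun i => Int.fract_nonneg _, fun i => (Int.fract_lt_one _).le⟩
  · rw [gridMk_eq_iff]
    refine ⟨congrArg Subtype.val h, ?_⟩
    rw [mem_latticeOf, mem_stdLattice]
    intro i
    exact ⟨⌊lin g'⁻¹ w i⌋, by simp [map_sub]⟩

/-! ### The injectivity radius -/

theorem translate_eq_translate_iff {g : SL d} {w u v : E d} :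
    (GridSpace.mk (g, w)).translate u = (GridSpace.mk (g, w)).translate v ↔
      v - u ∈ latticeOf g := by
  simp [gridMk_eq_iff]

/-- Two translations shorter than the injectivity radius that agree at `z` are equal. -/
theorem eq_of_translate_eq {z : GridSpace d} {u v : E d} (hu : ‖u‖ < injRadius z)
    (hv : ‖v‖ < injRadius z) (h : z.translate u = z.translate v) : u = v := by
  have hlt : max ‖u‖ ‖v‖ < injRadius z := max_lt hu hv
  obtain ⟨ρ, ⟨hρ, hinj⟩, hlt'⟩ : ∃ ρ ∈ {ρ | 0 < ρ ∧
      Set.InjOn (fun u : E d => z.translate u) (Metric.ball 0 ρ)}, max ‖u‖ ‖v‖ < ρ := by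
    apply exists_lt_of_lt_csSup _ hlt
    by_contra hne
    rw [Set.not_nonempty_iff_eq_empty] at hne
    rw [injRadius, hne, Real.sSup_empty] at hlt
    exact absurd hlt (not_lt.2 (le_max_of_le_left (norm_nonneg u)))
  exact hinj (by simpa using (le_max_left _ _).trans_lt hlt')
    (by simpa using (le_max_right _ _).trans_lt hlt') h

theorem one_le_norm_of_mem_stdLattice {v : E d} (hv : v ∈ stdLattice d) (h0 : v ≠ 0) :
    1 ≤ ‖v‖ := by
  obtain ⟨i, hi⟩ : ∃ i, v i ≠ 0 := by
    by_contra! h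
    exact h0 (by ext i; simpa using h i)
  obtain ⟨n, hn⟩ := mem_stdLattice.1 hv i
  have h1 : 1 ≤ |v i| := by
    rw [← hn] at hi ⊢
    have hn' : n ≠ 0 := by
      rintro rfl
      exact hi Int.cast_zero
    have h2 : ((1 : ℤ) : ℝ) ≤ ((|n| : ℤ) : ℝ) := Int.cast_le.2 (Int.one_le_abs hn')
    rwa [Int.cast_one, Int.cast_abs] at h2
  exact h1.trans (PiLp.norm_apply_le v i)

/-- The injectivity radius is bounded below over a compact set of lattices. -/
theorem exists_le_injRadius (hd : 0 < d) {K : Set (LatticeSpace d)} (hK : IsCompact K) :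
    ∃ ρ > 0, ∀ z : GridSpace d, proj z ∈ K → ρ ≤ injRadius z := by
  obtain ⟨C, hC, hCK⟩ := exists_compact_lift hK
  -- a common bound for the norms of the inverses of the elements of `C`
  obtain ⟨M, hM⟩ : ∃ M : ℝ, ∀ g ∈ C, ∀ v : E d, ‖v‖ ≤ 1 → ‖lin g⁻¹ v‖ ≤ M := by
    have hcont : Continuous fun p : SL d × E d => ‖lin p.1⁻¹ p.2‖ :=
      (continuous_lin_comp continuous_fst.inv continuous_snd).norm
    obtain ⟨M, hM⟩ := (hC.prod (isCompact_closedBall (0 : E d) 1)).bddAbove_image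
      hcont.continuousOn
    refine ⟨M, fun g hg v hv => hM ⟨(g, v), ⟨hg, by simpa using hv⟩, rfl⟩⟩
  set M' := max M 1
  have hM' : 0 < M' := lt_max_of_lt_right one_pos
  have hbound (g) (hg : g ∈ C) (v : E d) : ‖lin g⁻¹ v‖ ≤ M' * ‖v‖ := by
    rcases eq_or_ne v 0 with rfl | hv
    · simp
    have h1 := hM g hg ((‖v‖)⁻¹ • v) (by rw [norm_smul]; simp [hv])
    rw [map_smul, norm_smul, norm_inv, norm_norm, inv_mul_le_iff₀ (norm_pos_iff.2 hv)] at h1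
    rw [mul_comm]
    exact h1.trans (by gcongr; exact le_max_left _ _)
  refine ⟨1 / (2 * M'), by positivity, fun z hz => ?_⟩
  obtain ⟨⟨g₀, w⟩, rfl⟩ := exists_gridMk z
  rw [proj_gridMk] at hz
  obtain ⟨g, hg, h⟩ := hCK hz
  have hlat : latticeOf g = latticeOf g₀ := congrArg Subtype.val h
  apply le_csSup
  · refine ⟨‖lin g (EuclideanSpace.single ⟨0, hd⟩ 1)‖, ?_⟩
    rintro ρ ⟨hρ, hinj⟩
    by_contra! hlt
    set e : E d := EuclideanSpace.single ⟨0, hd⟩ 1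
    have hmem : lin g e ∈ latticeOf g₀ := by
      rw [← hlat, mem_latticeOf, lin_inv_lin, mem_stdLattice]
      intro i
      by_cases hi : i = ⟨0, hd⟩
      · exact ⟨1, by simp [e, hi]⟩
      · exact ⟨0, by simp [e, hi]⟩
    have h0 : lin g e = 0 := by
      refine hinj (by simpa using hlt) (by simpa using hρ) ?_
      refine translate_eq_translate_iff.2 ?_
      simpa using hmem
    have : e = 0 := by
      rw [← lin_inv_lin g e, h0, map_zero]
    have := congrArg norm this
    simp [e] at this
  · refine ⟨by positivity, ?_⟩
    intro u hu v hv huv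
    have hmem := translate_eq_translate_iff.1 huv
    rw [← hlat, mem_latticeOf] at hmem
    by_contra hne
    have hne' : lin g⁻¹ (v - u) ≠ 0 := by
      intro h0
      apply hne
      have : v - u = 0 := by rw [← lin_lin_inv g (v - u), h0, map_zero]
      exact (sub_eq_zero.1 this).symm
    have h1 := one_le_norm_of_mem_stdLattice hmem hne'
    have h2 := hbound g hg (v - u)
    have h3 : ‖v - u‖ < 1 / M' := by
      have := norm_sub_le v u
      simp only [Metric.mem_ball, dist_zero_right] at hu hv
      have : 1 / M' = 1 / (2 * M') + 1 / (2 * M') := by field_simp; norm_num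
      linarith
    have h4 : M' * ‖v - u‖ < 1 := by
      rwa [lt_div_iff₀ hM', mul_comm] at h3
    linarith

theorem fiberDist_translate_le (z : GridSpace d) (u : E d) : fiberDist z (z.translate u) ≤ ‖u‖ :=
  csInf_le ⟨0, by rintro _ ⟨v, -, rfl⟩; exact norm_nonneg v⟩ ⟨u, rfl, rfl⟩

theorem exists_translate_of_fiberDist_lt {z z' : GridSpace d} (h : proj z = proj z') {r : ℝ}
    (hr : fiberDist z z' < r) : ∃ u, z' = z.translate u ∧ ‖u‖ < r := by
  obtain ⟨u, hu⟩ := exists_translate_of_proj_eq h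
  obtain ⟨_, ⟨v, hv, rfl⟩, hlt⟩ := exists_lt_of_csInf_lt (s := {ρ | ∃ u : E d, z' = z.translate u ∧
    ρ = ‖u‖}) ⟨_, u, hu, rfl⟩ hr
  exact ⟨v, hv, hlt⟩

/-- Every grid has an open neighborhood whose fibers have small diameter. -/
theorem exists_isOpen_fiberDist_lt (z : GridSpace d) {r : ℝ} (hr : 0 < r) :
    ∃ O : Set (GridSpace d), IsOpen O ∧ z ∈ O ∧
      ∀ z₁ ∈ O, ∀ z₂ ∈ O, proj z₁ = proj z₂ → fiberDist z₁ z₂ < r := by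
  obtain ⟨⟨g, w⟩, rfl⟩ := exists_gridMk z
  refine ⟨GridSpace.mk '' (Set.univ ×ˢ Metric.ball w (r / 2)),
    isOpenQuotientMap_gridMk.isOpenMap _ (isOpen_univ.prod Metric.isOpen_ball),
    ⟨_, ⟨trivial, Metric.mem_ball_self (half_pos hr)⟩, rfl⟩, ?_⟩
  rintro _ ⟨⟨g₁, w₁⟩, ⟨-, h₁⟩, rfl⟩ _ ⟨⟨g₂, w₂⟩, ⟨-, h₂⟩, rfl⟩ h
  have hlat : latticeOf g₁ = latticeOf g₂ := by
    rw [proj_gridMk, proj_gridMk] at h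
    exact congrArg Subtype.val h
  have : GridSpace.mk (g₂, w₂) = (GridSpace.mk (g₁, w₁)).translate (w₂ - w₁) := by
    rw [translate_gridMk, gridMk_eq_iff]
    simp [hlat]
  rw [this]
  refine (fiberDist_translate_le _ _).trans_lt ?_
  have h3 := dist_triangle_right w₂ w₁ w
  simp only [Metric.mem_ball] at h₁ h₂
  rw [← dist_eq_norm]
  linarith

end Spaces

/-! ### Counting points in boxes -/

/-- A finite set contained in a box of sides `ℓ j`, cut into boxes of sides `s j` each of which
contains at most `B` of its points. Only the coordinates in `J` matter. -/
theorem card_le_of_box {d : ℕ} (F : Finset (E d)) (J : Finset (Fin d)) (ℓ s : Fin d → ℝ)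
    (hs : ∀ j ∈ J, 0 < s j) (hℓ : ∀ u ∈ F, ∀ v ∈ F, ∀ j ∈ J, |u j - v j| ≤ ℓ j) (B : ℕ)
    (hB : ∀ G ⊆ F, (∀ u ∈ G, ∀ v ∈ G, ∀ j ∈ J, |u j - v j| < s j) → G.card ≤ B) :
    F.card ≤ (∏ j ∈ J, (⌊ℓ j / s j⌋₊ + 1)) * B := by
  classical
  rcases F.eq_empty_or_nonempty with rfl | hF
  · simp
  set m : Fin d → ℝ := fun j => F.inf' hF fun u => u j
  have hm (u) (hu : u ∈ F) (j) : 0 ≤ u j - m j := sub_nonneg.2 (Finset.inf'_le _ hu)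
  have hmℓ (u) (hu : u ∈ F) (j) (hj : j ∈ J) : u j - m j ≤ ℓ j := by
    obtain ⟨v, hv, hvm⟩ := Finset.exists_mem_eq_inf' hF fun u : E d => u j
    have : m j = v j := hvm
    rw [this]
    exact (le_abs_self _).trans (hℓ u hu v hv j hj)
  set κ : E d → Fin d → ℕ := fun u j => if j ∈ J then ⌊(u j - m j) / s j⌋₊ else 0
  set t : Finset (Fin d → ℕ) :=
    Fintype.piFinset fun j => Finset.range (if j ∈ J then ⌊ℓ j / s j⌋₊ + 1 else 1)
  have ht : t.card = ∏ j ∈ J, (⌊ℓ j / s j⌋₊ + 1) := by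
    simp [t, Fintype.card_piFinset]
  rw [← ht, mul_comm]
  refine Finset.card_le_mul_card_image_of_maps_to (f := κ) ?_ B fun b _ => hB _ ?_ ?_
  · intro u hu
    simp only [t, κ, Fintype.mem_piFinset, Finset.mem_range]
    intro j
    split_ifs with hj
    · refine Nat.lt_succ_of_le (Nat.floor_le_floor ?_)
      have := hs j hj
      gcongr
      exact hmℓ u hu j hj
    · exact one_pos
  · exact Finset.filter_subset _ _
  · intro u hu v hv j hj
    rw [Finset.mem_filter] at hu hv
    have hκ : κ u j = κ v j := by rw [hu.2, hv.2]
    simp only [κ, if_pos hj] at hκ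
    have h1 : |(u j - m j) / s j - (v j - m j) / s j| < 1 := by
      have hu1 := Nat.floor_le (div_nonneg (hm u hu.1 j) (hs j hj).le)
      have hv1 := Nat.floor_le (div_nonneg (hm v hv.1 j) (hs j hj).le)
      have hu2 := Nat.lt_floor_add_one ((u j - m j) / s j)
      have hv2 := Nat.lt_floor_add_one ((v j - m j) / s j)
      rw [hκ] at hu1 hu2
      rw [abs_sub_lt_iff]
      constructor <;> linarith
    rw [← sub_div, abs_div, abs_of_pos (hs j hj), div_lt_one (hs j hj)] at h1
    simpa using h1

theorem norm_le_sum_abs {d : ℕ} (v : E d) : ‖v‖ ≤ ∑ j, |v j| := by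
  conv_lhs => rw [← (EuclideanSpace.basisFun (Fin d) ℝ).sum_repr v]
  refine (norm_sum_le _ _).trans (le_of_eq ?_)
  simp [norm_smul]

/-! ### The quasi-distance of a diagonal flow -/

namespace DiagFlow

variable {d : ℕ} (A : DiagFlow d)

/-- The indices of the positive exponents. -/
def pos : Finset (Fin d) := Finset.univ.filter fun j => 0 < A.c j

@[simp] theorem mem_pos {j : Fin d} : j ∈ A.pos ↔ 0 < A.c j := by simp [pos]

theorem exists_c_eq_one : ∃ j, A.c j = 1 := A.isGreatest_one.1

theorem c_le_one (j : Fin d) : A.c j ≤ 1 := A.isGreatest_one.2 ⟨j, rfl⟩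

instance : Nonempty {j : Fin d // 0 < A.c j} := by
  obtain ⟨j, hj⟩ := A.exists_c_eq_one
  exact ⟨⟨j, by simp [hj]⟩⟩

/-- Balls of the quasi-distance are boxes. -/
theorem qdist_lt_iff {u v : E d} {ρ : ℝ} (hρ : 0 < ρ) :
    A.qdist u v < ρ ↔ ∀ j ∈ A.pos, |u j - v j| < ρ ^ A.c j := by
  have key (j : Fin d) (hj : 0 < A.c j) :
      |u j - v j| ^ (1 / A.c j) < ρ ↔ |u j - v j| < ρ ^ A.c j := by
    rw [one_div, Real.rpow_inv_lt_iff_of_pos (abs_nonneg _) hρ.le hj]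
  constructor
  · intro h j hj
    rw [mem_pos] at hj
    rw [← key j hj]
    exact (le_ciSup (f := fun j : {j : Fin d // 0 < A.c j} => |u j - v j| ^ (1 / A.c j))
      (Set.finite_range _).bddAbove ⟨j, hj⟩).trans_lt h
  · intro h
    obtain ⟨j, hj⟩ := exists_eq_ciSup_of_finite
      (f := fun j : {j : Fin d // 0 < A.c j} => |u j - v j| ^ (1 / A.c j))
    rw [qdist, ← hj, key j j.2]
    exact h j (A.mem_pos.2 j.2)

theorem apply_eq_zero_of_mem {u : E d} (hu : u ∈ A.Uplus) {j : Fin d} (hj : j ∉ A.pos) :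
    u j = 0 := hu j (by simpa using hj)

theorem norm_sub_le_sum {u v : E d} (hu : u ∈ A.Uplus) (hv : v ∈ A.Uplus) :
    ‖u - v‖ ≤ ∑ j ∈ A.pos, |u j - v j| := by
  refine (norm_le_sum_abs _).trans (le_of_eq ?_)
  symm
  refine Finset.sum_subset (Finset.subset_univ _) fun j _ hj => ?_
  simp [A.apply_eq_zero_of_mem hu hj, A.apply_eq_zero_of_mem hv hj]

theorem dist_le_of_mem_qball {u v w : E d} {ρ : ℝ} (hρ : 0 < ρ) (hv : v ∈ A.qball u ρ)
    (hw : w ∈ A.qball u ρ) : dist v w ≤ ∑ j ∈ A.pos, 2 * ρ ^ A.c j := by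
  rw [dist_eq_norm]
  refine (A.norm_sub_le_sum hv.1 hw.1).trans (Finset.sum_le_sum fun j hj => ?_)
  have h1 := (A.qdist_lt_iff hρ).1 hv.2 j hj
  have h2 := (A.qdist_lt_iff hρ).1 hw.2 j hj
  have h3 := abs_sub_le (v j) (u j) (w j)
  rw [abs_sub_comm (v j) (u j)] at h3
  linarith

theorem isBounded_qball (u : E d) {ρ : ℝ} (hρ : 0 < ρ) :
    Bornology.IsBounded (A.qball u ρ) :=
  Metric.isBounded_iff.2 ⟨_, fun _ hv _ hw => A.dist_le_of_mem_qball hρ hv hw⟩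

/-- Small balls of the quasi-distance have small Euclidean diameter. -/
theorem exists_diam_qball_lt {ρ : ℝ} (hρ : 0 < ρ) :
    ∃ r, 0 < r ∧ r < 1 / 2 ∧ ∀ u, Metric.diam (A.qball u (3 * r)) < ρ := by
  have hlim : Tendsto (fun r : ℝ => ∑ j ∈ A.pos, 2 * (3 * r) ^ A.c j) (𝓝[>] 0) (𝓝 0) := by
    have : Tendsto (fun r : ℝ => ∑ j ∈ A.pos, 2 * (3 * r) ^ A.c j) (𝓝 0)
        (𝓝 (∑ j ∈ A.pos, 2 * (3 * 0) ^ A.c j)) := by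
      refine tendsto_finsetSum _ fun j hj => ?_
      refine Tendsto.const_mul _ ?_
      refine Tendsto.rpow_const (by exact (continuous_const.mul continuous_id).tendsto 0) ?_
      exact Or.inr (A.mem_pos.1 hj).le
    have h0 : ∑ j ∈ A.pos, 2 * (3 * (0 : ℝ)) ^ A.c j = 0 := by
      refine Finset.sum_eq_zero fun j hj => ?_
      rw [mul_zero, Real.zero_rpow (A.mem_pos.1 hj).ne', mul_zero]
    rw [h0] at this
    exact this.mono_left nhdsWithin_le_nhds
  have h1 : ∀ᶠ r : ℝ in 𝓝[>] 0, r < 1 / 2 :=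
    (eventually_lt_nhds (by norm_num)).filter_mono nhdsWithin_le_nhds
  obtain ⟨r, hr, hr1, hr0⟩ :=
    ((hlim.eventually_lt_const hρ).and (h1.and self_mem_nhdsWithin)).exists
  have hr0 : 0 < r := hr0
  refine ⟨r, hr0, hr1, fun u => (Metric.diam_le_of_forall_dist_le ?_ ?_).trans_lt hr⟩
  · positivity
  · exact fun v hv w hw => A.dist_le_of_mem_qball (by positivity) hv hw

/-! ### The flow on grids -/

theorem lin_mat (t : ℝ) (v : E d) (j : Fin d) :
    lin (A.mat t) v j = Real.exp (A.c j * t) * v j := by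
  rw [lin_apply]
  simp [mat, Matrix.mulVec_diagonal]

theorem mat_mul (s t : ℝ) : A.mat s * A.mat t = A.mat (s + t) := by
  apply Subtype.ext
  rw [Matrix.SpecialLinearGroup.coe_mul]
  simp [mat, mul_add, Real.exp_add]

theorem mat_zero : A.mat 0 = 1 := by
  apply Subtype.ext
  simp [mat]

theorem lin_mat_mem {u : E d} (hu : u ∈ A.Uplus) (t : ℝ) : lin (A.mat t) u ∈ A.Uplus := by
  intro i hi
  rw [lin_mat, hu i hi, mul_zero]

theorem iterate_flowY (n : ℕ) : (A.flowY 1)^[n] = A.flowY n := by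
  induction n with
  | zero =>
    ext z
    simp [flowY, mat_zero, act_one]
  | succ n ih =>
    rw [Function.iterate_succ', ih]
    ext z : 1
    simp [flowY, act_act, mat_mul, add_comm]

theorem flowY_translate (t : ℝ) (u : E d) (z : GridSpace d) :
    A.flowY t (z.translate u) = (A.flowY t z).translate (lin (A.mat t) u) :=
  act_translate _ _ _

theorem proj_flowY (t : ℝ) (z : GridSpace d) : proj (A.flowY t z) = A.flowX t (proj z) :=
  proj_act _ _

theorem proj_iterate_flowY (n : ℕ) (z : GridSpace d) :
    proj ((A.flowY 1)^[n] z) = (A.flowX 1)^[n] (proj z) := by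
  induction n with
  | zero => rfl
  | succ n ih => rw [Function.iterate_succ', Function.iterate_succ', Function.comp_apply,
      Function.comp_apply, proj_flowY, ih]

theorem continuous_flowY (t : ℝ) : Continuous (A.flowY t) := continuous_gridAct _

theorem abs_lin_mat_sub (t : ℝ) (u v : E d) (j : Fin d) :
    |lin (A.mat t) u j - lin (A.mat t) v j| = Real.exp (A.c j * t) * |u j - v j| := by
  rw [lin_mat, lin_mat, ← mul_sub, abs_mul, Real.abs_exp]

/-- The flow expands the quasi-distance by the factor `e^t`. -/
theorem qdist_lin_mat_lt_iff {t ρ : ℝ} (hρ : 0 < ρ) {u v : E d} :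
    A.qdist (lin (A.mat t) u) (lin (A.mat t) v) < ρ ↔
      A.qdist u v < ρ * Real.exp (-t) := by
  rw [A.qdist_lt_iff hρ, A.qdist_lt_iff (by positivity)]
  refine forall₂_congr fun j _ => ?_
  rw [abs_lin_mat_sub, Real.mul_rpow hρ.le (Real.exp_pos _).le, ← Real.exp_mul,
    ← lt_div_iff₀' (Real.exp_pos _), div_eq_mul_inv, ← Real.exp_neg]
  ring_nf

/-- At a time when two points of the leaf are at small quasi-distance and their images lie at
Euclidean distance less than `r` in a fiber of large injectivity radius, they are in fact at
quasi-distance less than `r`. -/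
theorem qdist_lt_of_fiberDist_lt {r : ℝ} (hr0 : 0 < r) (hr1 : r < 1 / 2) {z : GridSpace d}
    (hz : ∀ u ∈ A.Uplus, Metric.diam (A.qball u (3 * r)) < injRadius z) {p q : E d}
    (hp : p ∈ A.Uplus) (hq : q ∈ A.Uplus) (hpq : A.qdist p q < 3 * r)
    (hdist : fiberDist z (z.translate (q - p)) < r) : A.qdist p q < r := by
  obtain ⟨w, hw, hwr⟩ := exists_translate_of_fiberDist_lt (proj_translate _ _).symm hdist
  have h3 : 0 < 3 * r := by positivity
  have hself : p ∈ A.qball p (3 * r) :=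
    ⟨hp, (A.qdist_lt_iff h3).2 fun j _ => by simpa using Real.rpow_pos_of_pos h3 _⟩
  -- the ball has diameter at least `r`, in the direction of the exponent `1`
  have hdiam : r ≤ Metric.diam (A.qball p (3 * r)) := by
    obtain ⟨j, hj⟩ := A.exists_c_eq_one
    have hmem : p + r • EuclideanSpace.single j 1 ∈ A.qball p (3 * r) := by
      refine ⟨A.Uplus.add_mem hp (A.Uplus.smul_mem _ fun i hi => ?_), ?_⟩
      · have : i ≠ j := by
          rintro rfl
          exact hi (by rw [hj]; exact one_pos)
        simp [this]
      · rw [A.qdist_lt_iff h3]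
        intro i _
        by_cases hij : i = j
        · subst hij
          simp only [PiLp.add_apply, PiLp.smul_apply, hj, Real.rpow_one]
          simp [abs_of_pos hr0]
          linarith
        · simpa [hij] using Real.rpow_pos_of_pos h3 _
    have := Metric.dist_le_diam_of_mem (A.isBounded_qball p h3) hmem hself
    simpa [dist_eq_norm, norm_smul, abs_of_pos hr0] using this
  have hqp : q - p = w := by
    refine eq_of_translate_eq ?_ (hwr.trans_le (hdiam.trans (hz p hp).le)) hw
    rw [← dist_eq_norm]
    exact (Metric.dist_le_diam_of_mem (A.isBounded_qball p h3) ⟨hq, hpq⟩ hself).trans_lt (hz p hp)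
  rw [A.qdist_lt_iff hr0]
  intro j hj
  have h1 : |p j - q j| < r := by
    have := (PiLp.norm_apply_le w j).trans_lt hwr
    rwa [← hqp, Real.norm_eq_abs, PiLp.sub_apply, abs_sub_comm] at this
  refine h1.trans_le ?_
  conv_lhs => rw [← Real.rpow_one r]
  exact Real.rpow_le_rpow_of_exponent_ge hr0 (by linarith) (A.c_le_one j)

theorem prod_floor_le {x : Fin d → ℝ} (hx : ∀ j ∈ A.pos, x j < 3) :
    ∏ j ∈ A.pos, (⌊x j⌋₊ + 1) ≤ 3 ^ d := by
  calc ∏ j ∈ A.pos, (⌊x j⌋₊ + 1) ≤ ∏ j ∈ A.pos, 3 := by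
        refine Finset.prod_le_prod' fun j hj => ?_
        have := Nat.floor_lt' (n := 3) (a := x j) (by norm_num)
        have := this.2 (by exact_mod_cast hx j hj)
        omega
    _ = 3 ^ A.pos.card := by simp
    _ ≤ 3 ^ d := by
        refine Nat.pow_le_pow_right (by norm_num) ?_
        simpa using A.pos.card_le_univ

/-- Points of the unstable leaf that follow the same itinerary from time `n` to time `N`, are
close at time `n` and separated at time `N`: each time spent in the cusp multiplies the number of
such points by at most `3 ^ d`, and the other times do not increase it. -/
theorem card_le_of_itinerary {r : ℝ} (hr0 : 0 < r) (hr1 : r < 1 / 2) (y : GridSpace d)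
    (bad : ℕ → Prop) [DecidablePred bad] (N : ℕ) (k : ℕ) :
    ∀ (n : ℕ) (F : Finset (E d)), n + k = N → (∀ u ∈ F, u ∈ A.Uplus) →
      (∀ m < N, ¬ bad m → ∀ u ∈ F, ∀ p ∈ A.Uplus,
        Metric.diam (A.qball p (3 * r)) < injRadius (A.flowY m (y.translate u))) →
      (∀ m < N, ¬ bad m → ∀ u ∈ F, ∀ v ∈ F,
        fiberDist (A.flowY m (y.translate u)) (A.flowY m (y.translate v)) < r) →
      (∀ u ∈ F, ∀ v ∈ F, u ≠ v → Real.exp (-N) ≤ A.qdist u v) →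
      (∀ u ∈ F, ∀ v ∈ F, A.qdist u v < 3 * r * Real.exp (-n)) →
      F.card ≤ 3 ^ (d * (((Finset.Ico n N).filter bad).card + 1)) := by
  induction k with
  | zero =>
    intro n F hn hU hinj hfib hsep hclose
    obtain rfl : n = N := by simpa using hn
    have hbox := card_le_of_box F A.pos (fun j => (3 * r * Real.exp (-n)) ^ A.c j)
      (fun j => Real.exp (-n) ^ A.c j) (fun j _ => by positivity)
      (fun u hu v hv j hj =>
        ((A.qdist_lt_iff (by positivity)).1 (hclose u hu v hv) j hj).le) 1 ?_
    · have hprod := A.prod_floor_le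
        (x := fun j => (3 * r * Real.exp (-n)) ^ A.c j / Real.exp (-n) ^ A.c j) fun j hj => ?_
      · simpa using hbox.trans (Nat.mul_le_mul_right 1 hprod)
      · rw [Real.mul_rpow (by positivity) (by positivity), mul_div_assoc, div_self (by positivity),
          mul_one]
        calc (3 * r) ^ A.c j ≤ (3 / 2 : ℝ) ^ A.c j :=
              Real.rpow_le_rpow (by positivity) (by linarith) (A.mem_pos.1 hj).le
          _ ≤ (3 / 2 : ℝ) ^ (1 : ℝ) :=
              Real.rpow_le_rpow_of_exponent_le (by norm_num) (A.c_le_one j)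
          _ < 3 := by norm_num
    · intro G hG hGs
      rw [Finset.card_le_one]
      intro u hu v hv
      by_contra hne
      have h1 := hsep u (hG hu) v (hG hv) hne
      exact absurd h1 (not_le.2 ((A.qdist_lt_iff (Real.exp_pos _)).2 (hGs u hu v hv)))
  | succ k ih =>
    intro n F hn hU hinj hfib hsep hclose
    have hnN : n < N := by omega
    have hexp : Real.exp (-(n : ℝ)) = Real.exp (-((n + 1 : ℕ) : ℝ)) * Real.exp 1 := by
      rw [← Real.exp_add]
      push_cast
      ring_nf
    have hcard : ((Finset.Ico n N).filter bad).card =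
        (if bad n then 1 else 0) + ((Finset.Ico (n + 1) N).filter bad).card := by
      rw [← Finset.insert_Ico_add_one_left_eq_Ico hnN, Finset.filter_insert]
      split_ifs
      · rw [Finset.card_insert_of_notMem (by simp), add_comm]
      · simp
    by_cases hbad : bad n
    -- in the cusp, every side of the box is cut into at most `⌊e ^ c_j⌋ + 1 ≤ 3` pieces
    · set B := 3 ^ (d * (((Finset.Ico (n + 1) N).filter bad).card + 1)) with hB
      have hbox := card_le_of_box F A.pos (fun j => (3 * r * Real.exp (-n)) ^ A.c j)
        (fun j => (3 * r * Real.exp (-((n + 1 : ℕ) : ℝ))) ^ A.c j) (fun j _ => by positivity)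
        (fun u hu v hv j hj =>
          ((A.qdist_lt_iff (by positivity)).1 (hclose u hu v hv) j hj).le) B ?_
      · have hprod := A.prod_floor_le (x := fun j => (3 * r * Real.exp (-n)) ^ A.c j /
          (3 * r * Real.exp (-((n + 1 : ℕ) : ℝ))) ^ A.c j) fun j hj => ?_
        · refine (hbox.trans (Nat.mul_le_mul_right B hprod)).trans (le_of_eq ?_)
          rw [hB, ← pow_add, hcard, if_pos hbad]
          ring_nf
        · rw [hexp, ← mul_assoc, Real.mul_rpow (by positivity) (by positivity), mul_comm,
            mul_div_assoc, div_self (by positivity), mul_one, ← Real.exp_mul, one_mul]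
          calc Real.exp (A.c j) ≤ Real.exp 1 := Real.exp_le_exp.2 (A.c_le_one j)
            _ < 3 := Real.exp_one_lt_d9.trans (by norm_num)
      · intro G hG hGs
        exact ih (n + 1) G (by omega) (fun u hu => hU u (hG hu))
          (fun m hm hb u hu => hinj m hm hb u (hG hu))
          (fun m hm hb u hu v hv => hfib m hm hb u (hG hu) v (hG hv))
          (fun u hu v hv => hsep u (hG hu) v (hG hv))
          (fun u hu v hv => (A.qdist_lt_iff (by positivity)).2 (hGs u hu v hv))
    -- outside of the cusp, distances less than `3 r` are less than `r`, and `e r < 3 r`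
    · rw [hcard, if_neg hbad, zero_add]
      refine ih (n + 1) F (by omega) hU hinj hfib hsep fun u hu v hv => ?_
      have h1 : A.qdist (lin (A.mat n) u) (lin (A.mat n) v) < r := by
        refine A.qdist_lt_of_fiberDist_lt hr0 hr1 (hinj n hnN hbad u hu)
          (A.lin_mat_mem (hU u hu) _) (A.lin_mat_mem (hU v hv) _)
          ((A.qdist_lin_mat_lt_iff (by positivity)).2 (hclose u hu v hv)) ?_
        have := hfib n hnN hbad u hu v hv
        rwa [A.flowY_translate _ v, ← sub_add_cancel (lin (A.mat n) v) (lin (A.mat n) u),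
          ← translate_translate, ← A.flowY_translate] at this
      rw [A.qdist_lin_mat_lt_iff hr0, hexp] at h1
      refine h1.trans ?_
      have h2 : Real.exp 1 < 3 := Real.exp_one_lt_d9.trans (by norm_num)
      have h3 := Real.exp_pos (-((n + 1 : ℕ) : ℝ))
      nlinarith [mul_pos hr0 h3]

end DiagFlow

/-! ### Separated sets and Minkowski dimension -/

/-- `T` is a finite `δ`-separated subset of `S`. -/
def IsSep {α : Type*} (dist : α → α → ℝ) (S : Set α) (δ : ℝ) (T : Finset α) : Prop :=
  (↑T ⊆ S) ∧ ∀ u ∈ T, ∀ v ∈ T, u ≠ v → δ ≤ dist u v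

/-- If the cardinalities of the finite separated subsets are bounded, then `sepNumber` is the
cardinality of a largest one. -/
theorem exists_isSep_card_eq {α : Type*} {dist : α → α → ℝ} {S : Set α} {δ : ℝ} {M : ℕ}
    (hM : ∀ T, IsSep dist S δ T → T.card ≤ M) :
    ∃ T, IsSep dist S δ T ∧ sepNumber dist S δ = T.card ∧
      ∀ T', IsSep dist S δ T' → T'.card ≤ T.card := by
  obtain ⟨T, hT, hTs⟩ : ∃ T, IsSep dist S δ T ∧
      T.card = sSup (Finset.card '' {T | IsSep dist S δ T}) := by
    have hne : (Finset.card '' {T | IsSep dist S δ T}).Nonempty :=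
      ⟨_, ∅, ⟨by simp, by simp⟩, rfl⟩
    exact Nat.sSup_mem hne ⟨M, by rintro _ ⟨T, hT, rfl⟩; exact hM T hT⟩
  have hmax (T') (hT' : IsSep dist S δ T') : T'.card ≤ T.card := by
    rw [hTs]
    exact le_csSup ⟨M, by rintro _ ⟨T, hT, rfl⟩; exact hM T hT⟩ ⟨T', hT', rfl⟩
  refine ⟨T, hT, le_antisymm ?_ ?_, hmax⟩
  · refine iSup₂_le fun T' hT' => ?_
    have hfin : T'.Finite := by
      by_contra hinf
      obtain ⟨t, ht, htc⟩ := Set.Infinite.exists_subset_card_eq hinf (T.card + 1)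
      have := hmax t ⟨ht.trans hT'.1, fun u hu v hv => hT'.2 u (ht hu) v (ht hv)⟩
      omega
    rw [hfin.encard_eq_coe_toFinset_card]
    refine Nat.cast_le.2 (hmax _ ⟨by simpa using hT'.1, fun u hu v hv => hT'.2 u ?_ v ?_⟩)
    · simpa using hu
    · simpa using hv
  · rw [← Set.encard_coe_eq_coe_finsetCard]
    exact le_iSup₂ (f := fun (T : Set α) (_ : T ∈ {T : Set α | T ⊆ S ∧ ∀ u ∈ T, ∀ v ∈ T, u ≠ v →
      δ ≤ dist u v}) => T.encard) (T : Set α) hT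

theorem lowerMinkowskiDim_eq {α : Type*} {dist : α → α → ℝ} {S : Set α} {N : ℝ → ℕ}
    (hN : ∀ δ, 0 < δ → δ < 1 → sepNumber dist S δ = N δ ∧ 1 ≤ N δ) :
    lowerMinkowskiDim dist S =
      liminf (fun δ : ℝ => ((Real.log (N δ) / Real.log (1 / δ) : ℝ) : EReal)) (𝓝[>] 0) := by
  refine liminf_congr ?_
  filter_upwards [Ioo_mem_nhdsGT (zero_lt_one (α := ℝ))] with δ hδ
  obtain ⟨h1, h2⟩ := hN δ hδ.1 hδ.2
  have h3 : ((N δ : ℕ∞) : ℝ≥0∞) = ENNReal.ofReal (N δ) := by simp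
  rw [h1, h3, ENNReal.log_ofReal, if_neg (by simp; omega), EReal.coe_div]

theorem tendsto_const_div_log_one_div (C : ℝ) :
    Tendsto (fun δ : ℝ => C / Real.log (1 / δ)) (𝓝[>] 0) (𝓝 0) := by
  refine Tendsto.div_atTop tendsto_const_nhds (Real.tendsto_log_atTop.comp ?_)
  exact tendsto_inv_nhdsGT_zero.congr fun δ => (one_div δ).symm

namespace DiagFlow

variable {d : ℕ} (A : DiagFlow d)

theorem qdist_comm (u v : E d) : A.qdist u v = A.qdist v u := by
  simp only [qdist, abs_sub_comm]

theorem qdist_self_lt (u : E d) {δ : ℝ} (hδ : 0 < δ) : A.qdist u u < δ :=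
  (A.qdist_lt_iff hδ).2 fun j _ => by simpa using Real.rpow_pos_of_pos hδ _

/-- A bounded set whose subsets of small quasi-diameter have at most `B` points. -/
theorem card_le_of_norm_lt {R ρ : ℝ} (hρ : 0 < ρ) {F : Finset (E d)} (hF : ∀ u ∈ F, ‖u‖ < R)
    (B : ℕ) (hB : ∀ G ⊆ F, (∀ u ∈ G, ∀ v ∈ G, A.qdist u v < ρ) → G.card ≤ B) :
    F.card ≤ (∏ j ∈ A.pos, (⌊2 * R / ρ ^ A.c j⌋₊ + 1)) * B := by
  refine card_le_of_box F A.pos (fun _ => 2 * R) (fun j => ρ ^ A.c j)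
    (fun j _ => by positivity) (fun u hu v hv j _ => ?_) B fun G hG hGs => hB G hG
    fun u hu v hv => (A.qdist_lt_iff hρ).2 (hGs u hu v hv)
  have h1 := (PiLp.norm_apply_le u j).trans_lt (hF u hu)
  have h2 := (PiLp.norm_apply_le v j).trans_lt (hF v hv)
  have h3 := abs_sub (u j) (v j)
  rw [Real.norm_eq_abs] at h1 h2
  linarith

theorem exists_card_le_of_isSep {S : Set (E d)} {R : ℝ} (hS : ∀ u ∈ S, ‖u‖ < R) {δ : ℝ}
    (hδ : 0 < δ) : ∃ M, ∀ T, IsSep A.qdist S δ T → T.card ≤ M := by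
  refine ⟨_, fun T hT => A.card_le_of_norm_lt hδ (fun u hu => hS u (hT.1 hu)) 1 ?_⟩
  intro G hG hGs
  rw [Finset.card_le_one]
  intro u hu v hv
  by_contra hne
  exact absurd (hT.2 u (hG hu) v (hG hv) hne) (not_le.2 (hGs u hu v hv))

/-- A ball of radius `δ` for the quasi-distance is a box of sides `2 δ ^ c_j`, which contains a
controlled number of points at mutual Euclidean distance at least `δ`. -/
theorem card_le_card_mul_of_isSep (hd : 0 < d) {S : Set (E d)} (hSU : ∀ u ∈ S, u ∈ A.Uplus)
    {δ : ℝ} (hδ : 0 < δ) {T F : Finset (E d)} (hT : IsSep A.qdist S δ T)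
    (hmax : ∀ T', IsSep A.qdist S δ T' → T'.card ≤ T.card)
    (hF : IsSep (fun u v : E d => dist u v) S δ F) :
    F.card ≤ T.card * ∏ j ∈ A.pos, (⌊2 * δ ^ A.c j / (δ / d)⌋₊ + 1) := by
  classical
  have hcover : F ⊆ T.biUnion fun t => F.filter fun u => A.qdist t u < δ := by
    intro u hu
    rw [Finset.mem_biUnion]
    by_contra! hcon
    have hfar (t) (ht : t ∈ T) : δ ≤ A.qdist t u := by
      by_contra! hlt
      exact hcon t ht (Finset.mem_filter.2 ⟨hu, hlt⟩)
    have hnot : u ∉ T := fun h => absurd (hfar u h) (not_le.2 (A.qdist_self_lt u hδ))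
    have := hmax (insert u T) ⟨?_, ?_⟩
    · rw [Finset.card_insert_of_notMem hnot] at this
      omega
    · rw [Finset.coe_insert]
      exact Set.insert_subset (hF.1 hu) hT.1
    · intro a ha b hb hab
      rw [Finset.mem_insert] at ha hb
      rcases ha with rfl | ha <;> rcases hb with rfl | hb
      · exact absurd rfl hab
      · rw [qdist_comm]
        exact hfar b hb
      · exact hfar a ha
      · exact hT.2 a ha b hb hab
  refine (Finset.card_le_card hcover).trans (Finset.card_biUnion_le_card_mul _ _ _ fun t _ => ?_)
  have hd' : (0 : ℝ) < d := by exact_mod_cast hd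
  have := card_le_of_box (F.filter fun u => A.qdist t u < δ) A.pos (fun j => 2 * δ ^ A.c j)
    (fun _ => δ / d) (fun _ _ => by positivity) ?_ 1 ?_
  · simpa using this
  · intro u hu v hv j hj
    have h1 := (A.qdist_lt_iff hδ).1 (Finset.mem_filter.1 hu).2 j hj
    have h2 := (A.qdist_lt_iff hδ).1 (Finset.mem_filter.1 hv).2 j hj
    have h3 := abs_sub_le (u j) (t j) (v j)
    rw [abs_sub_comm (u j) (t j)] at h3
    linarith
  · intro G hG hGs
    rw [Finset.card_le_one]
    intro u hu v hv
    by_contra hne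
    have huF := (Finset.mem_filter.1 (hG hu)).1
    have hvF := (Finset.mem_filter.1 (hG hv)).1
    have h1 : δ ≤ ‖u - v‖ := by simpa [dist_eq_norm] using hF.2 u huF v hvF hne
    have h2 := A.norm_sub_le_sum (hSU u (hF.1 huF)) (hSU v (hF.1 hvF))
    have hne' : A.pos.Nonempty := by
      obtain ⟨j, hj⟩ := A.exists_c_eq_one
      exact ⟨j, by simp [hj]⟩
    have h3 : ∑ j ∈ A.pos, |u j - v j| < ∑ j ∈ A.pos, δ / d :=
      Finset.sum_lt_sum_of_nonempty hne' fun j hj => hGs u hu v hv j hj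
    have h4 : ∑ j ∈ A.pos, δ / d ≤ δ := by
      rw [Finset.sum_const, nsmul_eq_mul]
      have : (A.pos.card : ℝ) ≤ d := by
        exact_mod_cast (by simpa using A.pos.card_le_univ : A.pos.card ≤ d)
      calc (A.pos.card : ℝ) * (δ / d) ≤ d * (δ / d) := by gcongr
        _ = δ := by field_simp
    linarith

theorem prod_floor_div_le (hd : 0 < d) {δ : ℝ} (hδ : 0 < δ) (hδ1 : δ < 1) :
    ((∏ j ∈ A.pos, (⌊2 * δ ^ A.c j / (δ / d)⌋₊ + 1) : ℕ) : ℝ) ≤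
      (2 * d + 1) ^ A.pos.card * δ ^ (A.h - A.pos.card) := by
  have hh : A.h - A.pos.card = ∑ j ∈ A.pos, (A.c j - 1) := by
    simp [h, pos]
  rw [hh, Real.rpow_sum_of_pos hδ, ← Finset.prod_const, ← Finset.prod_mul_distrib]
  push_cast
  refine Finset.prod_le_prod (fun _ _ => by positivity) fun j _ => ?_
  have h1 : 1 ≤ δ ^ (A.c j - 1) :=
    Real.one_le_rpow_of_pos_of_le_one_of_nonpos hδ hδ1.le (by linarith [A.c_le_one j])
  have h2 : 2 * δ ^ A.c j / (δ / d) = 2 * d * δ ^ (A.c j - 1) := by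
    rw [Real.rpow_sub hδ, Real.rpow_one]
    field_simp
  rw [h2]
  have h3 := Nat.floor_le (a := 2 * d * δ ^ (A.c j - 1)) (by positivity)
  linarith

theorem finrank_Uplus : Module.finrank ℝ A.Uplus = A.pos.card := by
  classical
  have e : A.Uplus ≃ₗ[ℝ] (A.pos → ℝ) :=
    { toFun := fun u j => u.1 j
      map_add' := fun _ _ => rfl
      map_smul' := fun _ _ => rfl
      invFun := fun f => ⟨WithLp.toLp 2 fun i => if hi : i ∈ A.pos then f ⟨i, hi⟩ else 0,
        fun i hi => by simp [hi]⟩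
      left_inv := fun u => by
        ext i
        by_cases hi : i ∈ A.pos
        · simp only [dif_pos hi]
        · simp only [dif_neg hi]
          exact (A.apply_eq_zero_of_mem u.2 hi).symm
      right_inv := fun f => by
        ext j
        simp }
  rw [e.finrank_eq, Module.finrank_fintype_fun_eq_card, Fintype.card_coe]

/-- Comparison of the two lower Minkowski dimensions of a bounded subset of `U⁺`. -/
theorem lowerMinkowskiDim_dist_le (hd : 0 < d) {S : Set (E d)} (hne : S.Nonempty)
    (hSU : ∀ u ∈ S, u ∈ A.Uplus) {R : ℝ} (hS : ∀ u ∈ S, ‖u‖ < R) :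
    lowerMinkowskiDim (fun u v : E d => dist u v) S + (A.h : EReal)
      - ((Module.finrank ℝ A.Uplus : ℝ) : EReal) ≤ lowerMinkowskiDim A.qdist S := by
  have hTex (δ : ℝ) (hδ : 0 < δ) : ∃ T, IsSep A.qdist S δ T ∧ sepNumber A.qdist S δ = T.card ∧
      ∀ T', IsSep A.qdist S δ T' → T'.card ≤ T.card :=
    exists_isSep_card_eq (A.exists_card_le_of_isSep hS hδ).choose_spec
  choose! T hT hTs hTmax using hTex
  have hFex (δ : ℝ) (hδ : 0 < δ) : ∃ F, IsSep (fun u v : E d => dist u v) S δ F ∧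
      sepNumber (fun u v : E d => dist u v) S δ = F.card ∧
      ∀ T', IsSep (fun u v : E d => dist u v) S δ T' → T'.card ≤ F.card :=
    exists_isSep_card_eq fun F hF => A.card_le_card_mul_of_isSep hd hSU hδ (hT δ hδ) (hTmax δ hδ) hF
  choose! F hF hFs hFmax using hFex
  obtain ⟨u₀, hu₀⟩ := hne
  have hT1 (δ : ℝ) (hδ : 0 < δ) : 1 ≤ (T δ).card := by
    simpa using hTmax δ hδ {u₀} ⟨by simpa using hu₀, by simp⟩
  have hF1 (δ : ℝ) (hδ : 0 < δ) : 1 ≤ (F δ).card := by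
    simpa using hFmax δ hδ {u₀} ⟨by simpa using hu₀, by simp⟩
  rw [lowerMinkowskiDim_eq (N := fun δ => (T δ).card) fun δ hδ _ => ⟨hTs δ hδ, hT1 δ hδ⟩,
    lowerMinkowskiDim_eq (N := fun δ => (F δ).card) fun δ hδ _ => ⟨hFs δ hδ, hF1 δ hδ⟩,
    finrank_Uplus, sub_eq_add_neg, add_assoc, ← EReal.coe_neg, ← EReal.coe_add, ← sub_eq_add_neg]
  set C : ℝ := Real.log ((2 * d + 1) ^ A.pos.card)
  refine EReal.add_le_of_forall_lt fun a ha b hb => ?_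
  obtain ⟨x, hax, hx⟩ := EReal.lt_iff_exists_real_btwn.1 ha
  obtain ⟨x', hxx', hx'⟩ := EReal.lt_iff_exists_real_btwn.1 hx
  rw [EReal.coe_lt_coe_iff] at hxx'
  refine (add_le_add hax.le hb.le).trans ?_
  rw [← EReal.coe_add]
  refine le_liminf_of_le (by isBoundedDefault) ?_
  filter_upwards [eventually_lt_of_lt_liminf hx', Ioo_mem_nhdsGT (zero_lt_one (α := ℝ)),
    (tendsto_const_div_log_one_div C).eventually_lt_const (sub_pos.2 hxx')] with δ h1 hδ h2
  rw [EReal.coe_lt_coe_iff] at h1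
  rw [EReal.coe_le_coe_iff]
  have hL : 0 < Real.log (1 / δ) := Real.log_pos (by rw [lt_div_iff₀ hδ.1]; linarith [hδ.2])
  have hcard : ((F δ).card : ℝ) ≤
      (T δ).card * ((2 * d + 1) ^ A.pos.card * δ ^ (A.h - A.pos.card)) := by
    have := A.card_le_card_mul_of_isSep hd hSU hδ.1 (hT δ hδ.1) (hTmax δ hδ.1) (hF δ hδ.1)
    have h' : ((F δ).card : ℝ) ≤ (T δ).card *
        ((∏ j ∈ A.pos, (⌊2 * δ ^ A.c j / (δ / d)⌋₊ + 1) : ℕ) : ℝ) := by exact_mod_cast this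
    exact h'.trans (by gcongr; exact A.prod_floor_div_le hd hδ.1 hδ.2)
  have hTpos : (0 : ℝ) < (T δ).card := by exact_mod_cast hT1 δ hδ.1
  have hFpos : (0 : ℝ) < (F δ).card := by exact_mod_cast hF1 δ hδ.1
  have hlog := Real.log_le_log hFpos hcard
  rw [Real.log_mul hTpos.ne' (mul_pos (by positivity) (Real.rpow_pos_of_pos hδ.1 _)).ne',
    Real.log_mul (by positivity) (Real.rpow_pos_of_pos hδ.1 _).ne', Real.log_rpow hδ.1] at hlog
  have hLδ : Real.log δ = - Real.log (1 / δ) := by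
    rw [one_div, Real.log_inv, neg_neg]
  rw [hLδ] at hlog
  rw [lt_div_iff₀ hL] at h1
  rw [div_lt_iff₀ hL] at h2
  rw [le_div_iff₀ hL]
  have : C = Real.log ((2 * d + 1) ^ A.pos.card) := rfl
  nlinarith

end DiagFlow

/-! ### Shannon entropy of a uniformly distributed point -/

section Shannon

variable {α β γ : Type*}

open Classical in
/-- The number of points of `F` where `f` takes the same value as at `x`. -/
def fiberCard (F : Finset α) (f : α → β) (x : α) : ℕ := (F.filter fun x' => f x' = f x).card

/-- The Shannon entropy of `f x`, for `x` uniformly distributed in `F`, written as the mean of the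
information function. -/
def shannon (F : Finset α) (f : α → β) : ℝ :=
  (F.card : ℝ)⁻¹ * ∑ x ∈ F, Real.log (F.card / fiberCard F f x)

theorem fiberCard_pos {F : Finset α} {f : α → β} {x : α} (hx : x ∈ F) : 0 < fiberCard F f x := by
  classical
  exact Finset.card_pos.2 ⟨x, by simpa using hx⟩

theorem shannon_eq_sum [Fintype β] (F : Finset α) (f : α → β) [DecidableEq β] :
    shannon F f = ∑ b, Real.negMulLog ((F.filter fun x => f x = b).card / F.card) := by
  classical
  rw [shannon, ← Finset.sum_fiberwise F f, Finset.mul_sum]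
  refine Finset.sum_congr rfl fun b _ => ?_
  have : ∑ x ∈ F with f x = b, Real.log (F.card / fiberCard F f x) =
      ∑ x ∈ F with f x = b, Real.log (F.card / (F.filter fun x => f x = b).card) := by
    refine Finset.sum_congr rfl fun x hx => ?_
    rw [fiberCard, (Finset.mem_filter.1 hx).2]
    congr!
  rw [this, Finset.sum_const, nsmul_eq_mul, Real.negMulLog, ← inv_div, Real.log_inv]
  ring

/-- Coarser maps have smaller entropy. -/
theorem shannon_le_of_factor {F : Finset α} {f : α → β} {g : α → γ}
    (h : ∀ x ∈ F, ∀ x' ∈ F, g x' = g x → f x' = f x) : shannon F f ≤ shannon F g := by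
  classical
  refine mul_le_mul_of_nonneg_left (Finset.sum_le_sum fun x hx => ?_) (by positivity)
  have h1 : 0 < fiberCard F g x := fiberCard_pos hx
  have h2 : fiberCard F g x ≤ fiberCard F f x := by
    refine Finset.card_le_card fun x' hx' => ?_
    rw [Finset.mem_filter] at hx' ⊢
    exact ⟨hx'.1, h x hx x' hx'.1 hx'.2⟩
  have h3 : (0 : ℝ) < F.card := by exact_mod_cast Finset.card_pos.2 ⟨x, hx⟩
  have h4 : 0 < fiberCard F f x := h1.trans_le h2
  refine Real.log_le_log (by positivity) ?_
  gcongr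

/-- A map all of whose fibers are small has large entropy. -/
theorem le_shannon {F : Finset α} (hF : F.Nonempty) {f : α → β} {M : ℕ}
    (hM : ∀ x ∈ F, fiberCard F f x ≤ M) : Real.log F.card - Real.log M ≤ shannon F f := by
  have hN : (0 : ℝ) < F.card := by exact_mod_cast Finset.card_pos.2 hF
  rw [shannon, ← div_eq_inv_mul, le_div_iff₀ hN, mul_comm, ← nsmul_eq_mul]
  refine Finset.card_nsmul_le_sum _ _ _ fun x hx => ?_
  have h1 : (0 : ℝ) < fiberCard F f x := by exact_mod_cast fiberCard_pos hx
  rw [Real.log_div hN.ne' h1.ne']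
  have := Real.log_le_log h1 (by exact_mod_cast hM x hx : (fiberCard F f x : ℝ) ≤ M)
  linarith

theorem sum_fiberCard_div_le (F : Finset α) (f : α → β) (g : α → γ) :
    ∑ x ∈ F, (fiberCard F f x * fiberCard F g x / fiberCard F (fun x => (f x, g x)) x : ℝ) ≤
      F.card * F.card := by
  classical
  set I := F.image fun x => (f x, g x)
  have hmaps : ∀ x ∈ F, (f x, g x) ∈ I := fun x hx => Finset.mem_image_of_mem _ hx
  set nf : β → ℝ := fun b => (F.filter fun x => f x = b).card
  set ng : γ → ℝ := fun c => (F.filter fun x => g x = c).card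
  calc ∑ x ∈ F, (fiberCard F f x * fiberCard F g x / fiberCard F (fun x => (f x, g x)) x : ℝ)
      = ∑ p ∈ I, nf p.1 * ng p.2 := by
        rw [← Finset.sum_fiberwise_of_maps_to hmaps]
        refine Finset.sum_congr rfl fun p hp => ?_
        obtain ⟨x₀, hx₀, hp₀⟩ := Finset.mem_image.1 hp
        have hpos : (0 : ℝ) < (F.filter fun x => (f x, g x) = p).card := by
          exact_mod_cast Finset.card_pos.2 ⟨x₀, by simpa using ⟨hx₀, hp₀⟩⟩
        have : ∑ x ∈ F with (f x, g x) = p, (fiberCard F f x * fiberCard F g x /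
            fiberCard F (fun x => (f x, g x)) x : ℝ) = ∑ x ∈ F with (f x, g x) = p,
            (nf p.1 * ng p.2 / (F.filter fun x => (f x, g x) = p).card : ℝ) := by
          refine Finset.sum_congr rfl fun x hx => ?_
          have hxp := (Finset.mem_filter.1 hx).2
          simp only [fiberCard, hxp, nf, ng, ← congrArg Prod.fst hxp, ← congrArg Prod.snd hxp]
        rw [this, Finset.sum_const, nsmul_eq_mul]
        field_simp
    _ ≤ ∑ p ∈ F.image f ×ˢ F.image g, nf p.1 * ng p.2 := by
        refine Finset.sum_le_sum_of_subset_of_nonneg ?_ fun _ _ _ => by positivity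
        intro p hp
        obtain ⟨x₀, hx₀, rfl⟩ := Finset.mem_image.1 hp
        exact Finset.mk_mem_product (Finset.mem_image_of_mem _ hx₀) (Finset.mem_image_of_mem _ hx₀)
    _ = F.card * F.card := by
        rw [Finset.sum_product, ← Finset.sum_mul_sum]
        congr 1
        · rw [Finset.card_eq_sum_card_image f F]
          push_cast
          rfl
        · rw [Finset.card_eq_sum_card_image g F]
          push_cast
          rfl

/-- Subadditivity of the Shannon entropy. -/
theorem shannon_prod_le (F : Finset α) (f : α → β) (g : α → γ) :
    shannon F (fun x => (f x, g x)) ≤ shannon F f + shannon F g := by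
  rcases F.eq_empty_or_nonempty with rfl | hF
  · simp [shannon]
  have hN : (0 : ℝ) < F.card := by exact_mod_cast Finset.card_pos.2 hF
  rw [shannon, shannon, shannon, ← mul_add, ← Finset.sum_add_distrib]
  refine mul_le_mul_of_nonneg_left ?_ (by positivity)
  have key : ∀ x ∈ F, Real.log (F.card / fiberCard F (fun x => (f x, g x)) x) ≤
      Real.log (F.card / fiberCard F f x) + Real.log (F.card / fiberCard F g x) +
      ((fiberCard F f x * fiberCard F g x / fiberCard F (fun x => (f x, g x)) x : ℝ) / F.card
        - 1) := by
    intro x hx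
    have h1 : (0 : ℝ) < fiberCard F f x := by exact_mod_cast fiberCard_pos hx
    have h2 : (0 : ℝ) < fiberCard F g x := by exact_mod_cast fiberCard_pos hx
    have h3 : (0 : ℝ) < fiberCard F (fun x => (f x, g x)) x := by exact_mod_cast fiberCard_pos hx
    have h4 := Real.log_le_sub_one_of_pos (x := (fiberCard F f x * fiberCard F g x /
      fiberCard F (fun x => (f x, g x)) x : ℝ) / F.card) (by positivity)
    rw [Real.log_div (by positivity) hN.ne', Real.log_div (by positivity) h3.ne',
      Real.log_mul h1.ne' h2.ne'] at h4
    rw [Real.log_div hN.ne' h1.ne', Real.log_div hN.ne' h2.ne', Real.log_div hN.ne' h3.ne']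
    linarith
  refine (Finset.sum_le_sum key).trans ?_
  rw [Finset.sum_add_distrib, Finset.sum_sub_distrib, ← Finset.sum_div]
  have := sum_fiberCard_div_le F f g
  have h5 : (∑ x ∈ F, (fiberCard F f x * fiberCard F g x /
      fiberCard F (fun x => (f x, g x)) x : ℝ)) / F.card ≤ F.card := by
    rw [div_le_iff₀ hN]
    exact this
  simp only [Finset.sum_const, nsmul_eq_mul, mul_one]
  linarith

theorem shannon_nonneg (F : Finset α) (f : α → β) : 0 ≤ shannon F f := by
  classical
  refine mul_nonneg (by positivity) (Finset.sum_nonneg fun x hx => Real.log_nonneg ?_)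
  have h1 : (0 : ℝ) < fiberCard F f x := by exact_mod_cast fiberCard_pos hx
  rw [one_le_div h1]
  exact_mod_cast Finset.card_le_card (Finset.filter_subset _ _)

theorem shannon_le_card [Fintype β] (F : Finset α) (f : α → β) :
    shannon F f ≤ Fintype.card β := by
  classical
  rw [shannon_eq_sum]
  refine (Finset.sum_le_card_nsmul _ _ 1 fun b _ => ?_).trans (by simp)
  have h0 : (0 : ℝ) ≤ (F.filter fun x => f x = b).card / F.card := by positivity
  rcases h0.eq_or_lt with h | h
  · simp [← h]
  · have h1 := mul_le_mul_of_nonneg_left (Real.one_sub_inv_le_log_of_pos h) h0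
    rw [mul_sub, mul_inv_cancel₀ h.ne'] at h1
    rw [Real.negMulLog]
    linarith

/-- The word of length `L` read from time `s` on. -/
def word (label : ℕ → α → β) (s L : ℕ) (x : α) : Fin L → β := fun k => label (s + k) x

theorem word_eq_iff {label : ℕ → α → β} {s L : ℕ} {x x' : α} :
    word label s L x = word label s L x' ↔ ∀ m, s ≤ m → m < s + L → label m x = label m x' := by
  constructor
  · intro h m h1 h2
    have := congrFun h ⟨m - s, by omega⟩
    simpa [word, Nat.add_sub_cancel' h1] using this
  · intro h
    ext k
    exact h _ (by omega) (by omega)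

/-- A word is cut into consecutive words of length `q`, the last of which may protrude. -/
theorem shannon_word_le (F : Finset α) (label : ℕ → α → β) {q : ℕ} (hq : 1 ≤ q) (L : ℕ) :
    ∀ s, shannon F (word label s L) ≤
      ∑ n ∈ Finset.Ico s (s + L) with n % q = s % q, shannon F (word label n q) := by
  induction L using Nat.strong_induction_on with
  | _ L ih =>
    intro s
    rcases Nat.eq_zero_or_pos L with rfl | hL
    · refine (shannon_le_of_factor (g := fun _ => ()) fun x _ x' _ _ => ?_).trans
        (le_of_eq (by simp [shannon, fiberCard]))
      exact Subsingleton.elim _ _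
    · have h1 : shannon F (word label s L) ≤
          shannon F (word label s q) + shannon F (word label (s + q) (L - q)) := by
        refine (shannon_le_of_factor fun x _ x' _ h => ?_).trans (shannon_prod_le _ _ _)
        rw [Prod.mk.injEq, word_eq_iff, word_eq_iff] at h
        rw [word_eq_iff]
        intro m hm1 hm2
        by_cases hm : m < s + q
        · exact h.1 m hm1 hm
        · exact h.2 m (by omega) (by omega)
      refine h1.trans ((add_le_add_right (ih (L - q) (by omega) (s + q)) _).trans ?_)
      have hmem : s ∉ Finset.filter (fun n => n % q = (s + q) % q)
          (Finset.Ico (s + q) (s + q + (L - q))) := by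
        simp
        omega
      rw [← Finset.sum_insert (f := fun n => shannon F (word label n q)) hmem]
      refine Finset.sum_le_sum_of_subset_of_nonneg ?_ fun _ _ _ => shannon_nonneg _ _
      intro n hn
      simp only [Finset.mem_insert, Finset.mem_filter, Finset.mem_Ico, Nat.add_mod_right] at hn ⊢
      rcases hn with rfl | hn
      · exact ⟨⟨le_rfl, by omega⟩, rfl⟩
      · exact ⟨⟨by omega, by omega⟩, hn.2⟩

/-- The entropy of a long word is controlled by the entropies of all its subwords of
length `q`. -/
theorem mul_shannon_word_le [Fintype β] (F : Finset α) (label : ℕ → α → β) {q : ℕ} (hq : 1 ≤ q)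
    (N : ℕ) : q * shannon F (word label 0 N) ≤
      ∑ n ∈ Finset.range N, shannon F (word label n q) +
        q * ∑ r ∈ Finset.range q, (Fintype.card (Fin r → β) : ℝ) := by
  -- cut the word at the times congruent to `r` modulo `q`
  have key (r) (hr : r ∈ Finset.range q) : shannon F (word label 0 N) ≤
      ∑ r' ∈ Finset.range q, (Fintype.card (Fin r' → β) : ℝ) +
        ∑ n ∈ Finset.range N with n % q = r, shannon F (word label n q) := by
    rw [Finset.mem_range] at hr
    have h1 : shannon F (word label 0 N) ≤
        shannon F (word label 0 r) + shannon F (word label r (N - r)) := by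
      refine (shannon_le_of_factor fun x _ x' _ h => ?_).trans (shannon_prod_le _ _ _)
      rw [Prod.mk.injEq, word_eq_iff, word_eq_iff] at h
      rw [word_eq_iff]
      intro m hm1 hm2
      by_cases hm : m < r
      · exact h.1 m hm1 (by omega)
      · exact h.2 m (by omega) (by omega)
    refine h1.trans (add_le_add ((shannon_le_card _ _).trans ?_)
      ((shannon_word_le F label hq (N - r) r).trans ?_))
    · exact Finset.single_le_sum (f := fun r => (Fintype.card (Fin r → β) : ℝ))
        (fun _ _ => by positivity) (Finset.mem_range.2 hr)
    · refine Finset.sum_le_sum_of_subset_of_nonneg ?_ fun _ _ _ => shannon_nonneg _ _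
      intro n hn
      simp only [Finset.mem_filter, Finset.mem_Ico, Finset.mem_range, Nat.mod_eq_of_lt hr] at hn ⊢
      exact ⟨by omega, hn.2⟩
  have hsum := Finset.card_nsmul_le_sum _ _ _ key
  rw [Finset.card_range, nsmul_eq_mul, Finset.sum_add_distrib, Finset.sum_const,
    Finset.card_range, nsmul_eq_mul, Finset.sum_fiberwise_of_maps_to (fun n _ =>
      Finset.mem_range.2 (Nat.mod_lt n hq))] at hsum
  linarith

end Shannon

/-! ### Orbit measures and their limits -/

namespace DiagFlow

variable {d : ℕ} (A : DiagFlow d)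

/-- The uniform measure on the orbit segments `a^n (u + y)`, for `n < T` and `u ∈ F`. -/
def orbitMeasure (y : GridSpace d) (F : Finset (E d)) (T : ℕ) : Measure (GridSpace d) :=
  ((T * F.card : ℕ) : ℝ≥0∞)⁻¹ •
    ∑ p ∈ Finset.range T ×ˢ F, Measure.dirac (A.flowY p.1 (y.translate p.2))

/-- The mean of `f` over the points `a^n (u + y)`, for `u ∈ F`. -/
def fiberMean (y : GridSpace d) (F : Finset (E d)) (f : GridSpace d → ℝ) (n : ℕ) : ℝ :=
  (F.card : ℝ)⁻¹ * ∑ u ∈ F, f (A.flowY n (y.translate u))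

theorem integral_orbitMeasure (y : GridSpace d) (F : Finset (E d)) (T : ℕ)
    (f : GridSpace d → ℝ) : ∫ z, f z ∂A.orbitMeasure y F T =
      (T : ℝ)⁻¹ * ∑ n ∈ Finset.range T, A.fiberMean y F f n := by
  rw [orbitMeasure, integral_smul_measure, integral_finsetSum_measure]
  · simp only [integral_dirac, fiberMean, Finset.sum_product, ← Finset.mul_sum]
    rw [smul_eq_mul, ENNReal.toReal_inv, ENNReal.toReal_natCast]
    push_cast
    rw [mul_inv, mul_assoc]
  · exact fun p _ => integrable_dirac (by simp)

theorem isProbabilityMeasure_orbitMeasure (y : GridSpace d) {F : Finset (E d)} (hF : F.Nonempty)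
    {T : ℕ} (hT : 1 ≤ T) : IsProbabilityMeasure (A.orbitMeasure y F T) := by
  constructor
  have : 0 < T * F.card := Nat.mul_pos hT (Finset.card_pos.2 hF)
  simp only [orbitMeasure, Measure.smul_apply, Measure.finsetSum_apply, measure_univ,
    Finset.sum_const, Finset.card_product, Finset.card_range, smul_eq_mul, nsmul_eq_mul, mul_one]
  exact ENNReal.inv_mul_cancel (by exact_mod_cast this.ne') (ENNReal.natCast_ne_top _)

variable {A} in
theorem fiberMean_mono {y : GridSpace d} {F : Finset (E d)} {f g : GridSpace d → ℝ} {n : ℕ}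
    (h : ∀ u ∈ F, f (A.flowY n (y.translate u)) ≤ g (A.flowY n (y.translate u))) :
    A.fiberMean y F f n ≤ A.fiberMean y F g n :=
  mul_le_mul_of_nonneg_left (Finset.sum_le_sum h) (by positivity)

theorem fiberMean_const (y : GridSpace d) {F : Finset (E d)} (hF : F.Nonempty) (c : ℝ) (n : ℕ) :
    A.fiberMean y F (fun _ => c) n = c := by
  have : (F.card : ℝ) ≠ 0 := by exact_mod_cast (Finset.card_pos.2 hF).ne'
  rw [fiberMean, Finset.sum_const, nsmul_eq_mul]
  field_simp

theorem proj_flowY_translate (y : GridSpace d) (n : ℕ) (u : E d) :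
    proj (A.flowY n (y.translate u)) = (A.flowX 1)^[n] (proj y) := by
  rw [← iterate_flowY, proj_iterate_flowY, proj_translate]

theorem fiberMean_comp_proj (y : GridSpace d) {F : Finset (E d)} (hF : F.Nonempty)
    (f : LatticeSpace d → ℝ) (n : ℕ) :
    A.fiberMean y F (fun z => f (proj z)) n = f ((A.flowX 1)^[n] (proj y)) := by
  simp only [fiberMean, proj_flowY_translate]
  exact A.fiberMean_const y hF _ n

theorem integral_comp_proj_orbitMeasure (y : GridSpace d) {F : Finset (E d)} (hF : F.Nonempty)
    (T : ℕ) (f : LatticeSpace d → ℝ) : ∫ z, f (proj z) ∂A.orbitMeasure y F T =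
      1 / (T : ℝ) * ∑ n ∈ Finset.range T, f ((A.flowX 1)^[n] (proj y)) := by
  rw [integral_orbitMeasure]
  simp only [A.fiberMean_comp_proj y hF, one_div]

theorem measureReal_orbitMeasure (y : GridSpace d) (F : Finset (E d)) (T : ℕ)
    {s : Set (GridSpace d)} (hs : MeasurableSet s) : (A.orbitMeasure y F T).real s =
      (T : ℝ)⁻¹ * ∑ n ∈ Finset.range T, A.fiberMean y F (s.indicator fun _ => 1) n := by
  rw [← integral_orbitMeasure, integral_indicator_const _ hs, smul_eq_mul, mul_one]

theorem flowY_one_flowY (n : ℕ) (z : GridSpace d) :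
    A.flowY 1 (A.flowY n z) = A.flowY (n + 1 : ℕ) z := by
  rw [← iterate_flowY, ← iterate_flowY, Function.iterate_succ_apply']

theorem abs_integral_orbitMeasure_sub_le (y : GridSpace d) {F : Finset (E d)} (hF : F.Nonempty)
    (T : ℕ) {f : GridSpace d → ℝ} {M : ℝ} (hM : ∀ z, |f z| ≤ M) :
    |∫ z, f (A.flowY 1 z) ∂A.orbitMeasure y F T - ∫ z, f z ∂A.orbitMeasure y F T| ≤
      2 * M / T := by
  have hb (n) : |A.fiberMean y F f n| ≤ M := by
    rw [abs_le]
    refine ⟨?_, ?_⟩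
    · rw [← A.fiberMean_const y hF (-M) n]
      exact fiberMean_mono fun u _ => (abs_le.1 (hM _)).1
    · rw [← A.fiberMean_const y hF M n]
      exact fiberMean_mono fun u _ => (abs_le.1 (hM _)).2
  have hs (n) : A.fiberMean y F (fun z => f (A.flowY 1 z)) n = A.fiberMean y F f (n + 1) := by
    simp only [fiberMean, flowY_one_flowY]
  rw [integral_orbitMeasure, integral_orbitMeasure, ← mul_sub, ← Finset.sum_sub_distrib]
  simp only [hs]
  rw [Finset.sum_range_sub, abs_mul, abs_of_nonneg (by positivity), ← div_eq_inv_mul]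
  gcongr
  have := abs_sub (A.fiberMean y F f T) (A.fiberMean y F f 0)
  have := hb T
  have := hb 0
  linarith

section Limit

variable {y : GridSpace d} {F : ℕ → Finset (E d)} {T : ℕ → ℕ}
  {μ₀ : ProbabilityMeasure (LatticeSpace d)}

/-- The test functions of the definition of `orbitLimits` include the continuous functions with
compact support. -/
theorem tendsto_of_hasCompactSupport {x : LatticeSpace d}
    (hlim : ∀ f : C₀(LatticeSpace d, ℝ),
      Tendsto (fun k => (1 / (T k : ℝ)) * ∑ i ∈ Finset.range (T k), f ((A.flowX 1)^[i] x)) atTop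
        (𝓝 (∫ z, f z ∂(μ₀ : Measure (LatticeSpace d)))))
    {f : LatticeSpace d → ℝ} (hf : Continuous f) (hfc : HasCompactSupport f) :
    Tendsto (fun k => (1 / (T k : ℝ)) * ∑ i ∈ Finset.range (T k), f ((A.flowX 1)^[i] x)) atTop
        (𝓝 (∫ z, f z ∂(μ₀ : Measure (LatticeSpace d)))) :=
  hlim ⟨⟨f, hf⟩, hfc.is_zero_at_infty⟩

/-- Since `π` is proper and the projections of the orbit measures converge to a probability
measure, no mass escapes to infinity. -/
theorem isTightMeasureSet_orbitMeasure (hT : StrictMono T) (hF : ∀ k, (F k).Nonempty)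
    (hT1 : ∀ k, 1 ≤ T k)
    (hlim : ∀ f : C₀(LatticeSpace d, ℝ),
      Tendsto (fun k => (1 / (T k : ℝ)) * ∑ i ∈ Finset.range (T k), f ((A.flowX 1)^[i] (proj y)))
        atTop (𝓝 (∫ z, f z ∂(μ₀ : Measure (LatticeSpace d))))) :
    IsTightMeasureSet (Set.range fun k => A.orbitMeasure y (F k) (T k)) := by
  rw [isTightMeasureSet_iff_exists_isCompact_measure_compl_le]
  intro ε' hε'
  obtain ⟨ε, hε, hεε'⟩ : ∃ ε : ℝ, 0 < ε ∧ ENNReal.ofReal ε ≤ ε' := by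
    rcases eq_or_ne ε' ⊤ with rfl | h
    · exact ⟨1, one_pos, le_top⟩
    · exact ⟨ε'.toReal, ENNReal.toReal_pos hε'.ne' h, ENNReal.ofReal_toReal h |>.le⟩
  obtain ⟨K, -, hK, hμK⟩ := (MeasurableSet.univ (α := LatticeSpace d)).exists_isCompact_lt_add
    (μ := (μ₀ : Measure (LatticeSpace d))) (measure_ne_top _ _)
    (ε := ENNReal.ofReal ε) (by simpa using hε)
  obtain ⟨χ, hχ1, -, hχc, hχ⟩ := exists_continuous_one_zero_of_isCompact hK isClosed_empty
    (Set.disjoint_empty K)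
  have hint : 1 - ε < ∫ z, χ z ∂(μ₀ : Measure (LatticeSpace d)) := by
    have h1 : (μ₀ : Measure (LatticeSpace d)).real K ≤ ∫ z, χ z ∂(μ₀ : Measure _) := by
      rw [← integral_indicator_one hK.measurableSet]
      refine integral_mono ((integrable_const 1).indicator hK.measurableSet)
        (χ.continuous.integrable_of_hasCompactSupport hχc) fun z => ?_
      by_cases hz : z ∈ K
      · simp [hz, hχ1 hz]
      · simpa [hz] using (hχ z).1
    have h2 : (1 : ℝ) < (μ₀ : Measure (LatticeSpace d)).real K + ε := by
      rw [measure_univ] at hμK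
      have := (ENNReal.toReal_lt_toReal (by simp) (by simp [measure_ne_top])).2 hμK
      rwa [ENNReal.toReal_add (measure_ne_top _ _) (by simp), ENNReal.toReal_one,
        ENNReal.toReal_ofReal hε.le] at this
    linarith
  obtain ⟨k₀, hk₀⟩ := eventually_atTop.1
    ((A.tendsto_of_hasCompactSupport hlim χ.continuous hχc).eventually_const_lt hint)
  -- the orbit points before time `T k₀` take care of the measures of index less than `k₀`
  set K' : Set (LatticeSpace d) :=
    tsupport χ ∪ (fun n => (A.flowX 1)^[n] (proj y)) '' (Finset.range (T k₀) : Set ℕ)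
  have hK' : IsCompact K' := hχc.isCompact.union ((Finset.finite_toSet _).image _).isCompact
  refine ⟨proj ⁻¹' K', isCompact_preimage_proj hK', ?_⟩
  rintro _ ⟨k, rfl⟩
  have hmeas : MeasurableSet (proj ⁻¹' K')ᶜ :=
    (hK'.isClosed.preimage continuous_proj).measurableSet.compl
  have := A.isProbabilityMeasure_orbitMeasure y (hF k) (hT1 k)
  refine le_trans ?_ hεε'
  rw [← ofReal_measureReal]
  refine ENNReal.ofReal_le_ofReal ?_
  have hT0 : (T k : ℝ) ≠ 0 := by exact_mod_cast (Nat.one_le_iff_ne_zero.1 (hT1 k))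
  rw [A.measureReal_orbitMeasure y _ _ hmeas]
  rcases le_or_gt k₀ k with hk | hk
  · have h1 := hk₀ k hk
    have h2 : ∀ n ∈ Finset.range (T k), A.fiberMean y (F k)
        ((proj ⁻¹' K')ᶜ.indicator fun _ => 1) n ≤ 1 - χ ((A.flowX 1)^[n] (proj y)) := by
      intro n _
      rw [← A.fiberMean_comp_proj y (hF k) (fun x => 1 - χ x)]
      refine fiberMean_mono fun u _ => ?_
      generalize A.flowY n (y.translate u) = z
      by_cases hz : proj z ∈ K'
      · simpa [hz] using (hχ (proj z)).2
      · have : χ (proj z) = 0 := image_eq_zero_of_notMem_tsupport fun h => hz (Or.inl h)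
        simp [hz, this]
    have h3 := mul_le_mul_of_nonneg_left (Finset.sum_le_sum h2) (by positivity : 0 ≤ (T k : ℝ)⁻¹)
    rw [Finset.sum_sub_distrib, mul_sub, Finset.sum_const, Finset.card_range, nsmul_eq_mul,
      mul_one, inv_mul_cancel₀ hT0, ← one_div] at h3
    rw [← one_div]
    linarith
  · have h2 : ∀ n ∈ Finset.range (T k), A.fiberMean y (F k)
        ((proj ⁻¹' K')ᶜ.indicator fun _ => 1) n ≤ 0 := by
      intro n hn
      rw [← A.fiberMean_const y (hF k) 0 n]
      refine fiberMean_mono fun u _ => ?_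
      have hz : proj (A.flowY n (y.translate u)) ∈ K' := by
        rw [proj_flowY_translate]
        refine Or.inr ⟨n, ?_, rfl⟩
        simpa using (Finset.mem_range.1 hn).trans (hT hk)
      simp [hz]
    exact (mul_nonpos_of_nonneg_of_nonpos (by positivity) (Finset.sum_nonpos h2)).trans hε.le

/-- The orbit measure, as a probability measure. -/
def orbitProb (y : GridSpace d) (hF : ∀ k, (F k).Nonempty) (hT1 : ∀ k, 1 ≤ T k) (k : ℕ) :
    ProbabilityMeasure (GridSpace d) :=
  ⟨A.orbitMeasure y (F k) (T k), A.isProbabilityMeasure_orbitMeasure y (hF k) (hT1 k)⟩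

/-- The orbit measures converge along an ultrafilter. -/
theorem exists_tendsto_orbitProb (hT : StrictMono T) (hF : ∀ k, (F k).Nonempty)
    (hT1 : ∀ k, 1 ≤ T k)
    (hlim : ∀ f : C₀(LatticeSpace d, ℝ),
      Tendsto (fun k => (1 / (T k : ℝ)) * ∑ i ∈ Finset.range (T k), f ((A.flowX 1)^[i] (proj y)))
        atTop (𝓝 (∫ z, f z ∂(μ₀ : Measure (LatticeSpace d))))) :
    ∃ μ, Tendsto (A.orbitProb y hF hT1) (hyperfilter ℕ) (𝓝 μ) := by
  have htight : IsTightMeasureSet {x | ∃ μ ∈ Set.range (A.orbitProb y hF hT1),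
      (μ : Measure (GridSpace d)) = x} := by
    convert A.isTightMeasureSet_orbitMeasure (y := y) hT hF hT1 hlim using 1
    ext ν
    constructor
    · rintro ⟨_, ⟨k, rfl⟩, rfl⟩
      exact ⟨k, rfl⟩
    · rintro ⟨k, rfl⟩
      exact ⟨_, ⟨k, rfl⟩, rfl⟩
  obtain ⟨μ, -, hμ⟩ := (isCompact_closure_of_isTightMeasureSet htight).ultrafilter_le_nhds
    ((hyperfilter ℕ).map (A.orbitProb y hF hT1)) (by
      rw [le_principal_iff, Ultrafilter.coe_map]
      exact mem_of_superset range_mem_map subset_closure)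
  exact ⟨μ, hμ⟩

variable {hF : ∀ k, (F k).Nonempty} {hT1 : ∀ k, 1 ≤ T k} {μ : ProbabilityMeasure (GridSpace d)}

theorem tendsto_integral_orbitMeasure
    (hμ : Tendsto (A.orbitProb y hF hT1) (hyperfilter ℕ) (𝓝 μ)) {f : GridSpace d → ℝ}
    (hf : Continuous f) {M : ℝ} (hM : ∀ z, |f z| ≤ M) :
    Tendsto (fun k => ∫ z, f z ∂A.orbitMeasure y (F k) (T k)) (hyperfilter ℕ)
      (𝓝 (∫ z, f z ∂(μ : Measure (GridSpace d)))) :=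
  ProbabilityMeasure.tendsto_iff_forall_integral_tendsto.1 hμ
    (BoundedContinuousFunction.ofNormedAddCommGroup f hf M hM)

theorem tendsto_div_atTop_hyperfilter (hT : StrictMono T) (c : ℝ) :
    Tendsto (fun k => c / (T k : ℝ)) (hyperfilter ℕ) (𝓝 0) :=
  (Tendsto.div_atTop tendsto_const_nhds
    (tendsto_natCast_atTop_atTop.comp hT.tendsto_atTop)).mono_left Nat.hyperfilter_le_atTop

theorem measurePreserving_of_tendsto (hT : StrictMono T)
    (hμ : Tendsto (A.orbitProb y hF hT1) (hyperfilter ℕ) (𝓝 μ)) :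
    MeasurePreserving (A.flowY 1) (μ : Measure (GridSpace d)) (μ : Measure (GridSpace d)) := by
  have hcont := A.continuous_flowY 1
  refine ⟨hcont.measurable, ?_⟩
  have := Measure.isProbabilityMeasure_map (μ := (μ : Measure (GridSpace d))) hcont.aemeasurable
  refine ext_of_forall_integral_eq_of_IsFiniteMeasure fun f => ?_
  rw [integral_map hcont.aemeasurable (by fun_prop)]
  have hM (z) : |f z| ≤ ‖f‖ := f.norm_coe_le_norm z
  have h1 := A.tendsto_integral_orbitMeasure hμ (f.continuous.comp hcont) fun z => hM _
  have h2 := A.tendsto_integral_orbitMeasure hμ f.continuous hM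
  have h3 : Tendsto (fun k => ∫ z, f (A.flowY 1 z) ∂A.orbitMeasure y (F k) (T k) -
      ∫ z, f z ∂A.orbitMeasure y (F k) (T k)) (hyperfilter ℕ) (𝓝 0) :=
    squeeze_zero_norm (fun k => A.abs_integral_orbitMeasure_sub_le y (hF k) (T k) hM)
      (tendsto_div_atTop_hyperfilter hT _)
  exact sub_eq_zero.1 (tendsto_nhds_unique (h1.sub h2) h3)

theorem map_proj_of_tendsto
    (hlim : ∀ f : C₀(LatticeSpace d, ℝ),
      Tendsto (fun k => (1 / (T k : ℝ)) * ∑ i ∈ Finset.range (T k), f ((A.flowX 1)^[i] (proj y)))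
        atTop (𝓝 (∫ z, f z ∂(μ₀ : Measure (LatticeSpace d)))))
    (hμ : Tendsto (A.orbitProb y hF hT1) (hyperfilter ℕ) (𝓝 μ)) :
    Measure.map proj (μ : Measure (GridSpace d)) = (μ₀ : Measure (LatticeSpace d)) := by
  have := Measure.isProbabilityMeasure_map (μ := (μ : Measure (GridSpace d)))
    continuous_proj.aemeasurable
  refine Measure.ext_of_integral_eq_on_compactlySupported fun f => ?_
  rw [integral_map continuous_proj.aemeasurable (by fun_prop)]
  obtain ⟨M, hM⟩ := f.hasCompactSupport.exists_bound_of_continuous f.continuous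
  have h1 := A.tendsto_integral_orbitMeasure hμ (f.continuous.comp continuous_proj) fun z => hM _
  have h2 := (A.tendsto_of_hasCompactSupport hlim f.continuous f.hasCompactSupport).mono_left
    Nat.hyperfilter_le_atTop
  refine tendsto_nhds_unique h1 (h2.congr fun k => ?_)
  exact (A.integral_comp_proj_orbitMeasure y (hF k) (T k) f).symm

theorem support_subset_of_tendsto (hT : StrictMono T) {S : Set (GridSpace d)}
    (hS : ∀ k, ∀ u ∈ F k, y.translate u ∈ S)
    (hμ : Tendsto (A.orbitProb y hF hT1) (hyperfilter ℕ) (𝓝 μ)) (s : ℕ) :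
    (μ : Measure (GridSpace d)).support ⊆
      closure (⋃ (t : ℝ) (_ : (s : ℝ) ≤ t), A.flowY t '' S) := by
  set O := (closure (⋃ (t : ℝ) (_ : (s : ℝ) ≤ t), A.flowY t '' S))ᶜ
  have hO : IsOpen O := isClosed_closure.isOpen_compl
  suffices (μ : Measure (GridSpace d)) O = 0 by
    have := Measure.subset_compl_support_of_isOpen hO this
    exact Set.compl_subset_compl.1 this
  have hle := ProbabilityMeasure.le_liminf_measure_open_of_tendsto hμ hO
  have hlim : Tendsto (fun k => (A.orbitProb y hF hT1 k : Measure (GridSpace d)) O)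
      (hyperfilter ℕ) (𝓝 0) := by
    have h1 : Tendsto (fun k => ENNReal.ofReal (s / T k)) (hyperfilter ℕ) (𝓝 0) := by
      simpa using ENNReal.tendsto_ofReal (tendsto_div_atTop_hyperfilter hT (s : ℝ))
    refine tendsto_of_tendsto_of_tendsto_of_le_of_le tendsto_const_nhds h1
      (fun _ => zero_le) fun k => ?_
    rw [← ofReal_measureReal]
    refine ENNReal.ofReal_le_ofReal ?_
    have : (A.orbitProb y hF hT1 k : Measure (GridSpace d)) = A.orbitMeasure y (F k) (T k) := rfl
    rw [this, A.measureReal_orbitMeasure y _ _ hO.measurableSet, div_eq_inv_mul]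
    gcongr
    have hn : ∀ n ∈ Finset.range (T k), A.fiberMean y (F k) (O.indicator fun _ => 1) n ≤
        if n ∈ Finset.range s then 1 else 0 := by
      intro n _
      split_ifs with h
      · refine (fiberMean_mono (g := fun _ => 1) fun u _ => ?_).trans
          (A.fiberMean_const y (hF k) 1 n).le
        exact Set.indicator_le_self' (f := fun _ => (1 : ℝ)) (fun _ _ => zero_le_one) _
      · rw [← A.fiberMean_const y (hF k) 0 n]
        refine fiberMean_mono fun u hu => ?_
        rw [Set.indicator_of_notMem]
        intro hmem
        refine hmem (subset_closure ?_)
        simp only [Set.mem_iUnion]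
        exact ⟨n, by simpa using h, _, hS k u hu, rfl⟩
    refine (Finset.sum_le_sum hn).trans ?_
    rw [← Finset.sum_filter, Finset.sum_const, nsmul_eq_mul, mul_one]
    have : ((Finset.range (T k)).filter fun n => n ∈ Finset.range s) ⊆ Finset.range s :=
      fun n hn => (Finset.mem_filter.1 hn).2
    exact_mod_cast (Finset.card_le_card this).trans (by simp)
  rw [hlim.liminf_eq] at hle
  exact le_antisymm hle zero_le

end Limit

end DiagFlow

/-! ### Semicontinuity of the relative entropy -/

/-- One half of the convergence of the integrals of a function whose discontinuities are
negligible for the limit measure. -/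
theorem eventually_integral_indicator_lt {Ω ι : Type*} [TopologicalSpace Ω] [MeasurableSpace Ω]
    [BorelSpace Ω] [HasOuterApproxClosed Ω] {L : Filter ι} {μs : ι → ProbabilityMeasure Ω}
    {μ : ProbabilityMeasure Ω} (hμ : Tendsto μs L (𝓝 μ)) {Q : Set Ω} (hQ : MeasurableSet Q)
    (hfr : (μ : Measure Ω) (frontier Q) = 0) {h : Ω → ℝ} (hc : Continuous h) (h0 : ∀ z, 0 ≤ h z)
    {M : ℝ} (hM : ∀ z, h z ≤ M) {ε : ℝ} (hε : 0 < ε) :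
    ∀ᶠ i in L, ∫ z, Q.indicator h z ∂(μs i : Measure Ω) <
      ∫ z, Q.indicator h z ∂(μ : Measure Ω) + ε := by
  have hcl : IsClosed (closure Q) := isClosed_closure
  have heq : ∫ z, Q.indicator h z ∂(μ : Measure Ω) =
      ∫ z, (closure Q).indicator h z ∂(μ : Measure Ω) :=
    integral_congr_ae (indicator_ae_eq_of_ae_eq_set (closure_ae_eq_of_null_frontier hfr).symm)
  set χ : ℕ → Ω → ℝ := fun n z => (hcl.apprSeq n z : ℝ) * h z
  have hχc (n) : Continuous (χ n) :=
    (NNReal.continuous_coe.comp (hcl.apprSeq n).continuous).mul hc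
  have hχ1 (n z) : ((hcl.apprSeq n z : NNReal) : ℝ) ≤ 1 := by
    exact_mod_cast HasOuterApproxClosed.apprSeq_apply_le_one hcl n z
  have hχM (n z) : ‖χ n z‖ ≤ M := by
    rw [Real.norm_of_nonneg (mul_nonneg NNReal.zero_le_coe (h0 z))]
    exact (mul_le_of_le_one_left (h0 z) (hχ1 n z)).trans (hM z)
  have hlim : Tendsto (fun n => ∫ z, χ n z ∂(μ : Measure Ω)) atTop
      (𝓝 (∫ z, (closure Q).indicator h z ∂(μ : Measure Ω))) := by
    refine tendsto_integral_of_dominated_convergence (fun _ => M)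
      (fun n => (hχc n).aestronglyMeasurable) (integrable_const _)
      (fun n => Eventually.of_forall (hχM n)) (Eventually.of_forall fun z => ?_)
    have h1 := tendsto_pi_nhds.1 (HasOuterApproxClosed.tendsto_apprSeq hcl) z
    have h2 := ((NNReal.continuous_coe.tendsto _).comp h1).mul_const (h z)
    refine h2.congr' (Eventually.of_forall fun n => rfl) |>.trans_eq ?_
    by_cases hz : z ∈ closure Q <;> simp [hz]
  obtain ⟨n, hn⟩ := (hlim.eventually_lt_const (lt_add_of_pos_right _ hε)).exists
  have hlim' : Tendsto (fun i => ∫ z, χ n z ∂(μs i : Measure Ω)) L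
      (𝓝 (∫ z, χ n z ∂(μ : Measure Ω))) :=
    ProbabilityMeasure.tendsto_iff_forall_integral_tendsto.1 hμ
      (BoundedContinuousFunction.ofNormedAddCommGroup (χ n) (hχc n) M (hχM n))
  rw [heq]
  filter_upwards [hlim'.eventually_lt_const hn] with i hi
  refine lt_of_le_of_lt (integral_mono ?_ ?_ fun z => ?_) hi
  · exact (Integrable.of_bound hc.aestronglyMeasurable M (Eventually.of_forall fun z => by
      rw [Real.norm_of_nonneg (h0 z)]; exact hM z)).indicator hQ
  · exact Integrable.of_bound (hχc n).aestronglyMeasurable M (Eventually.of_forall (hχM n))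
  · by_cases hz : z ∈ Q
    · simp [hz, χ, HasOuterApproxClosed.apprSeq_apply_eq_one hcl n (subset_closure hz)]
    · simpa [hz] using mul_nonneg NNReal.zero_le_coe (h0 z)

/-- The graph of `negMulLog` lies below its tangent at `g`. -/
theorem negMulLog_le_tangent {t g : ℝ} (ht : 0 ≤ t) (hg : 0 < g) :
    Real.negMulLog t ≤ t * (-Real.log g) - t + g := by
  rcases ht.eq_or_lt with rfl | ht
  · simpa using hg.le
  · have h1 := Real.log_le_sub_one_of_pos (x := g / t) (by positivity)
    rw [Real.log_div hg.ne' ht.ne'] at h1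
    have h2 := mul_le_mul_of_nonneg_left h1 ht.le
    have h3 : t * (g / t - 1) = g - t := by field_simp
    rw [h3] at h2
    rw [Real.negMulLog]
    linarith

/-- The tangent at a truncation of `w`, which is close to `t`, is close to `negMulLog` at `t`. -/
theorem tangent_le_negMulLog_add {t w e : ℝ} (ht0 : 0 ≤ t) (ht1 : t ≤ 1) (he : 0 < e) :
    t * (-Real.log (max e (min 1 w))) - t + max e (min 1 w) ≤
      Real.negMulLog t + e + (1 / e + 1) * |t - w| := by
  set G := max e (min 1 w)
  set t' := max e t
  have hG : e ≤ G := le_max_left _ _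
  have ht' : e ≤ t' := le_max_left _ _
  have hdist : |t' - G| ≤ |t - w| := by
    have h1 : |t' - G| ≤ |t - min 1 w| := by
      have := abs_max_sub_max_le_max e t e (min 1 w)
      simpa [t', G] using this
    have h2 : |t - min 1 w| ≤ |t - w| := by
      have := abs_min_sub_min_le_max 1 t 1 w
      rw [min_eq_right ht1] at this
      simpa using this
    exact h1.trans h2
  have hlog : Real.log t' - Real.log G ≤ 1 / e * |t - w| := by
    have hG0 : 0 < G := he.trans_le hG
    have h1 := Real.log_le_sub_one_of_pos (x := t' / G) (div_pos (he.trans_le ht') hG0)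
    rw [Real.log_div (he.trans_le ht').ne' hG0.ne'] at h1
    refine h1.trans ?_
    have : t' / G - 1 = (t' - G) / G := by field_simp
    rw [this, div_le_iff₀ hG0]
    calc t' - G ≤ |t' - G| := le_abs_self _
      _ ≤ |t - w| := hdist
      _ = 1 / e * |t - w| * e := by field_simp
      _ ≤ 1 / e * |t - w| * G := by gcongr
  have h1 : t * (-Real.log G) ≤ Real.negMulLog t + 1 / e * |t - w| := by
    have h2 : t * Real.log t ≤ t * Real.log t' := by
      rcases ht0.eq_or_lt with h | h
      · simp [← h]
      · exact mul_le_mul_of_nonneg_left (Real.log_le_log h (le_max_right _ _)) ht0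
    have h3 : t * (Real.log t' - Real.log G) ≤ 1 * (1 / e * |t - w|) :=
      (mul_le_mul_of_nonneg_left hlog ht0).trans
        (mul_le_mul_of_nonneg_right ht1 (by positivity))
    rw [Real.negMulLog]
    linarith
  have h2 : G - t ≤ e + |t - w| := by
    have h3 : t' ≤ e + t := max_le (by linarith) (by linarith)
    have := neg_abs_le (t' - G)
    linarith
  linarith

theorem fiberAlgebra_le (d : ℕ) : fiberAlgebra d ≤ borel (GridSpace d) := by
  have := (continuous_proj (d := d)).measurable
  exact measurable_iff_comap_le.1 this

section CondExp

variable {d : ℕ}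

/-- The conditional probability of `Q` relative to the base. -/
abbrev condProb (μ : Measure (GridSpace d)) (Q : Set (GridSpace d)) : GridSpace d → ℝ :=
  μ[Q.indicator (fun _ => (1 : ℝ)) | fiberAlgebra d]

variable (μ : Measure (GridSpace d)) [IsProbabilityMeasure μ] {Q : Set (GridSpace d)}

theorem condProb_mem_Icc (hQ : MeasurableSet Q) : ∀ᵐ z ∂μ, condProb μ Q z ∈ Set.Icc 0 1 := by
  have hint : Integrable (Q.indicator fun _ => (1 : ℝ)) μ := (integrable_const _).indicator hQ
  have h0 : 0 ≤ᵐ[μ] condProb μ Q :=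
    condExp_nonneg (Eventually.of_forall fun z => Set.indicator_nonneg (fun _ _ => zero_le_one) z)
  have h1 : condProb μ Q ≤ᵐ[μ] μ[fun _ => (1 : ℝ) | fiberAlgebra d] :=
    condExp_mono hint (integrable_const _) (Eventually.of_forall fun z =>
      Set.indicator_le_self' (f := fun _ => (1 : ℝ)) (fun _ _ => zero_le_one) z)
  rw [condExp_const (fiberAlgebra_le d)] at h1
  filter_upwards [h0, h1] with z hz0 hz1
  exact ⟨hz0, hz1⟩

theorem negMulLog_le_one {t : ℝ} (ht : 0 ≤ t) : Real.negMulLog t ≤ 1 := by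
  have := negMulLog_le_tangent ht one_pos
  simp at this
  linarith

theorem integrable_negMulLog_condProb (hQ : MeasurableSet Q) :
    Integrable (fun z => Real.negMulLog (condProb μ Q z)) μ := by
  refine Integrable.of_bound (C := 1) ?_ ?_
  · have h1 : StronglyMeasurable (condProb μ Q) :=
      stronglyMeasurable_condExp.mono (fiberAlgebra_le d)
    exact (Real.continuous_negMulLog.comp_stronglyMeasurable h1).aestronglyMeasurable
  · filter_upwards [condProb_mem_Icc μ hQ] with z hz
    rw [Real.norm_of_nonneg (Real.negMulLog_nonneg hz.1 hz.2)]
    exact negMulLog_le_one hz.1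

/-- The relative entropy of a finite family, as a sum of Bochner integrals. -/
theorem relEntropy_eq_ofReal {ι : Type*} [Fintype ι] {P : ι → Set (GridSpace d)}
    (hP : ∀ j, MeasurableSet (P j)) : relEntropy (fiberAlgebra d) μ P =
      ENNReal.ofReal (∑ j, ∫ z, Real.negMulLog (condProb μ (P j) z) ∂μ) := by
  have hpos (j) : 0 ≤ᵐ[μ] fun z => Real.negMulLog (condProb μ (P j) z) := by
    filter_upwards [condProb_mem_Icc μ (hP j)] with z hz
    exact Real.negMulLog_nonneg hz.1 hz.2
  rw [relEntropy, tsum_fintype,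
    ENNReal.ofReal_sum_of_nonneg fun j _ => integral_nonneg_of_ae (hpos j)]
  refine Finset.sum_congr rfl fun j _ => ?_
  rw [ofReal_integral_eq_lintegral_ofReal (integrable_negMulLog_condProb μ (hP j)) (hpos j)]

/-- Functions of the base point can be pulled out of the conditional probability. -/
theorem integral_indicator_mul_comp_proj (hQ : MeasurableSet Q) {f : LatticeSpace d → ℝ}
    (hf : Continuous f) {M : ℝ} (hM : ∀ x, |f x| ≤ M) :
    ∫ z, Q.indicator (fun z => f (proj z)) z ∂μ = ∫ z, condProb μ Q z * f (proj z) ∂μ := by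
  have hint : Integrable (Q.indicator fun _ => (1 : ℝ)) μ := (integrable_const _).indicator hQ
  have hfm : StronglyMeasurable[fiberAlgebra d] fun z => f (proj z) := by
    have : Measurable[fiberAlgebra d] fun z : GridSpace d => f (proj z) :=
      hf.measurable.comp (comap_measurable proj)
    exact this.stronglyMeasurable
  have h1 := condExp_stronglyMeasurable_mul_of_bound (fiberAlgebra_le d) (μ := μ) hfm hint M
    (Eventually.of_forall fun z => hM _)
  have h2 := integral_condExp (μ := μ) (fiberAlgebra_le d)
    (f := (fun z => f (proj z)) * Q.indicator fun _ => (1 : ℝ))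
  rw [integral_congr_ae h1] at h2
  have h3 : ∀ z, Q.indicator (fun z => f (proj z)) z =
      ((fun z => f (proj z)) * Q.indicator fun _ => (1 : ℝ)) z := by
    intro z
    by_cases hz : z ∈ Q <;> simp [hz]
  simp_rw [h3]
  rw [← h2]
  exact integral_congr_ae (Eventually.of_forall fun z => mul_comm _ _)

/-- The conditional entropy of `Q` is approached by the integrals of tangents whose slopes depend
continuously on the base point. -/
theorem exists_continuous_tangent (hQ : MeasurableSet Q) {ε : ℝ} (hε : 0 < ε) :
    ∃ (e : ℝ) (g : LatticeSpace d → ℝ), 0 < e ∧ Continuous g ∧ (∀ x, e ≤ g x ∧ g x ≤ 1) ∧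
      ∫ z, Q.indicator (fun z => -Real.log (g (proj z))) z ∂μ - μ.real Q + ∫ z, g (proj z) ∂μ ≤
        ∫ z, Real.negMulLog (condProb μ Q z) ∂μ + ε := by
  obtain ⟨h, hsm, hh⟩ : ∃ h : LatticeSpace d → ℝ, StronglyMeasurable h ∧ condProb μ Q = h ∘ proj :=
    StronglyMeasurable.exists_eq_measurable_comp stronglyMeasurable_condExp
  have hm : Measurable (proj (d := d)) := continuous_proj.measurable
  have := Measure.isProbabilityMeasure_map (μ := μ) hm.aemeasurable
  set e := min 1 (ε / 2)
  have he : 0 < e := lt_min one_pos (half_pos hε)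
  have hintc : Integrable (condProb μ Q) μ := integrable_condExp
  have hint : Integrable h (μ.map proj) := by
    rw [integrable_map_measure hsm.aestronglyMeasurable hm.aemeasurable, ← hh]
    exact hintc
  have hδ : 0 < ε / 2 / (1 / e + 1) := by positivity
  obtain ⟨w, -, hw, hwc, hwi⟩ := hint.exists_hasCompactSupport_integral_sub_le hδ
  -- truncation away from `0` keeps the logarithm of the approximation bounded
  set g : LatticeSpace d → ℝ := fun x => max e (min 1 (w x))
  have hgc : Continuous g := by fun_prop
  have hg (x) : e ≤ g x ∧ g x ≤ 1 := ⟨le_max_left _ _, max_le (min_le_left _ _) (min_le_left _ _)⟩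
  have hg0 (x) : 0 < g x := he.trans_le (hg x).1
  have hlogc : Continuous fun x => -Real.log (g x) :=
    (hgc.log fun x => (hg0 x).ne').neg
  have hlogM (x) : |-Real.log (g x)| ≤ -Real.log e := by
    rw [abs_of_nonneg (neg_nonneg.2 (Real.log_nonpos (hg0 x).le (hg x).2))]
    exact neg_le_neg (Real.log_le_log he (hg x).1)
  refine ⟨e, g, he, hgc, hg, ?_⟩
  have hw' : ∫ z, |condProb μ Q z - w (proj z)| ∂μ ≤ ε / 2 / (1 / e + 1) := by
    have hsub : AEStronglyMeasurable (fun x => ‖h x - w x‖) (μ.map proj) :=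
      (hint.sub hwi).norm.aestronglyMeasurable
    rw [integral_map hm.aemeasurable hsub] at hw
    rw [hh]
    exact hw
  have hwint : Integrable (fun z => |condProb μ Q z - w (proj z)|) μ :=
    (hintc.sub (hwi.comp_measurable hm)).norm
  have hreal : μ.real Q = ∫ z, condProb μ Q z ∂μ := by
    rw [integral_condExp (fiberAlgebra_le d), integral_indicator_const _ hQ, smul_eq_mul, mul_one]
  have hgint : Integrable (fun z => g (proj z)) μ :=
    Integrable.of_bound (hgc.comp continuous_proj).aestronglyMeasurable 1
      (Eventually.of_forall fun z => by
        rw [Real.norm_of_nonneg (hg0 _).le]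
        exact (hg _).2)
  have hmulint : Integrable (fun z => condProb μ Q z * -Real.log (g (proj z))) μ :=
    hintc.mul_bdd (c := -Real.log e) (hlogc.comp continuous_proj).aestronglyMeasurable
      (Eventually.of_forall fun z => hlogM _)
  have hsubint : Integrable
      (fun z => condProb μ Q z * -Real.log (g (proj z)) - condProb μ Q z) μ := hmulint.sub hintc
  rw [integral_indicator_mul_comp_proj μ hQ hlogc hlogM, hreal, ← integral_sub hmulint hintc,
    ← integral_add hsubint hgint]
  have hφ := integrable_negMulLog_condProb μ hQ
  have hle : ∫ z, (condProb μ Q z * -Real.log (g (proj z)) - condProb μ Q z + g (proj z)) ∂μ ≤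
      ∫ z, (Real.negMulLog (condProb μ Q z) + e +
        (1 / e + 1) * |condProb μ Q z - w (proj z)|) ∂μ := by
    refine integral_mono_ae (hsubint.add hgint)
      ((hφ.add (integrable_const _)).add (hwint.const_mul _)) ?_
    filter_upwards [condProb_mem_Icc μ hQ] with z hz
    exact tangent_le_negMulLog_add hz.1 hz.2 he
  refine hle.trans ?_
  have hφe : Integrable (fun z => Real.negMulLog (condProb μ Q z) + e) μ :=
    hφ.add (integrable_const _)
  rw [integral_add hφe (hwint.const_mul _), integral_add hφ (integrable_const _),
    integral_const_mul]
  have h1 : (1 / e + 1) * ∫ z, |condProb μ Q z - w (proj z)| ∂μ ≤ ε / 2 := by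
    calc _ ≤ (1 / e + 1) * (ε / 2 / (1 / e + 1)) := by gcongr
      _ = ε / 2 := by field_simp
  have h2 : e ≤ ε / 2 := min_le_right _ _
  simp only [integral_const, probReal_univ, one_smul]
  linarith

end CondExp

namespace DiagFlow

variable {d : ℕ} (A : DiagFlow d) {y : GridSpace d} {F : ℕ → Finset (E d)} {T : ℕ → ℕ}
  {hF : ∀ k, (F k).Nonempty} {hT1 : ∀ k, 1 ≤ T k} {μ : ProbabilityMeasure (GridSpace d)}

/-- Upper semicontinuity of the entropy: on average along the orbit, the entropy of `Q` on a fiber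
is asymptotically at most its conditional entropy for the limit measure. -/
theorem eventually_avg_negMulLog_le
    (hμ : Tendsto (A.orbitProb y hF hT1) (hyperfilter ℕ) (𝓝 μ)) {Q : Set (GridSpace d)}
    (hQ : MeasurableSet Q) (hfr : (μ : Measure (GridSpace d)) (frontier Q) = 0) {ε : ℝ}
    (hε : 0 < ε) : ∀ᶠ k in (hyperfilter ℕ : Filter ℕ), (T k : ℝ)⁻¹ * ∑ n ∈ Finset.range (T k),
      Real.negMulLog (A.fiberMean y (F k) (Q.indicator fun _ => 1) n) ≤
        ∫ z, Real.negMulLog (condProb (μ : Measure (GridSpace d)) Q z)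
          ∂(μ : Measure (GridSpace d)) + ε := by
  obtain ⟨e, g, he, hgc, hg, hle⟩ :=
    exists_continuous_tangent (μ : Measure (GridSpace d)) hQ (half_pos hε)
  have hg0 (x) : 0 < g x := he.trans_le (hg x).1
  have hlogc : Continuous fun x => -Real.log (g x) := (hgc.log fun x => (hg0 x).ne').neg
  have hlog0 (x) : 0 ≤ -Real.log (g x) := neg_nonneg.2 (Real.log_nonpos (hg0 x).le (hg x).2)
  have hlogM (x) : -Real.log (g x) ≤ -Real.log e := neg_le_neg (Real.log_le_log he (hg x).1)
  have h1 := eventually_integral_indicator_lt hμ hQ hfr (hlogc.comp continuous_proj)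
    (fun z => hlog0 _) (fun z => hlogM _) (by positivity : 0 < ε / 6)
  have h2 : Tendsto (fun k => (A.orbitMeasure y (F k) (T k)).real Q) (hyperfilter ℕ)
      (𝓝 ((μ : Measure (GridSpace d)).real Q)) := by
    have := ProbabilityMeasure.tendsto_measure_of_null_frontier_of_tendsto' hμ hfr
    exact (ENNReal.tendsto_toReal (measure_ne_top _ _)).comp this
  have h3 := A.tendsto_integral_orbitMeasure hμ (hgc.comp continuous_proj) (M := 1) fun z => by
    simp only [Function.comp_apply]
    rw [abs_of_pos (hg0 _)]
    exact (hg _).2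
  filter_upwards [h1, h2.eventually_const_lt (sub_lt_self _ (by positivity : 0 < ε / 6)),
    h3.eventually_lt_const (lt_add_of_pos_right _ (by positivity : 0 < ε / 6))] with k hk1 hk2 hk3
  have hprob : (A.orbitProb y hF hT1 k : Measure (GridSpace d)) = A.orbitMeasure y (F k) (T k) :=
    rfl
  -- on the fiber over `a^n x`, use the tangent at `g (a^n x)`
  have key : (T k : ℝ)⁻¹ * ∑ n ∈ Finset.range (T k),
      Real.negMulLog (A.fiberMean y (F k) (Q.indicator fun _ => 1) n) ≤
      ∫ z, Q.indicator (fun z => -Real.log (g (proj z))) z ∂A.orbitMeasure y (F k) (T k) -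
        (A.orbitMeasure y (F k) (T k)).real Q +
        ∫ z, g (proj z) ∂A.orbitMeasure y (F k) (T k) := by
    rw [A.measureReal_orbitMeasure y _ _ hQ, A.integral_orbitMeasure, A.integral_orbitMeasure,
      ← mul_sub, ← Finset.sum_sub_distrib, ← mul_add, ← Finset.sum_add_distrib]
    refine mul_le_mul_of_nonneg_left (Finset.sum_le_sum fun n _ => ?_) (by positivity)
    have hν : 0 ≤ A.fiberMean y (F k) (Q.indicator fun _ => 1) n := by
      rw [← A.fiberMean_const y (hF k) 0 n]
      exact fiberMean_mono fun u _ => Set.indicator_nonneg (fun _ _ => zero_le_one) _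
    refine (negMulLog_le_tangent hν (hg0 ((A.flowX 1)^[n] (proj y)))).trans (le_of_eq ?_)
    rw [A.fiberMean_comp_proj y (hF k) g]
    congr 2
    rw [fiberMean, fiberMean, mul_assoc, Finset.sum_mul]
    congr 1
    refine Finset.sum_congr rfl fun u _ => ?_
    by_cases hz : A.flowY n (y.translate u) ∈ Q
    · simp [hz, proj_flowY_translate]
    · simp [hz]
  have hk1' : ∫ z, Q.indicator (fun z => -Real.log (g (proj z))) z ∂A.orbitMeasure y (F k) (T k) <
      ∫ z, Q.indicator (fun z => -Real.log (g (proj z))) z ∂(μ : Measure (GridSpace d)) + ε / 6 :=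
    hk1
  have hk3' : ∫ z, g (proj z) ∂A.orbitMeasure y (F k) (T k) <
      ∫ z, g (proj z) ∂(μ : Measure (GridSpace d)) + ε / 6 := hk3
  linarith

end DiagFlow

/-! ### Partitions with negligible boundary -/

section NullFrontier

variable {α : Type*} [TopologicalSpace α] [MeasurableSpace α] {μ : Measure α} {s t : Set α}

theorem measure_frontier_inter (hs : μ (frontier s) = 0) (ht : μ (frontier t) = 0) :
    μ (frontier (s ∩ t)) = 0 :=
  measure_mono_null ((frontier_inter_subset s t).trans
    (Set.union_subset_union Set.inter_subset_left Set.inter_subset_right))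
    (measure_union_null hs ht)

theorem measure_frontier_union (hs : μ (frontier s) = 0) (ht : μ (frontier t) = 0) :
    μ (frontier (s ∪ t)) = 0 :=
  measure_mono_null ((frontier_union_subset s t).trans
    (Set.union_subset_union Set.inter_subset_left Set.inter_subset_right))
    (measure_union_null hs ht)

theorem measure_frontier_iInter {ι : Type*} [Fintype ι] {f : ι → Set α}
    (hf : ∀ i, μ (frontier (f i)) = 0) : μ (frontier (⋂ i, f i)) = 0 := by
  have := Finset.inf_induction (s := Finset.univ) (f := f) (p := fun s => μ (frontier s) = 0)
    (by simp) (fun s hs t ht => measure_frontier_inter hs ht) fun i _ => hf i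
  rwa [Finset.inf_univ_eq_iInf] at this

theorem measure_frontier_disjointed {n : ℕ} {f : Fin n → Set α}
    (hf : ∀ i, μ (frontier (f i)) = 0) (i : Fin n) : μ (frontier (disjointed f i)) = 0 := by
  rw [disjointed, Set.sdiff_eq]
  refine measure_frontier_inter (hf i) ?_
  rw [frontier_compl]
  exact Finset.sup_induction (p := fun s => μ (frontier s) = 0) (by simp)
    (fun s hs t ht => measure_frontier_union hs ht) fun i _ => hf i

theorem measure_frontier_preimage {T : α → α} (hT : MeasurePreserving T μ μ) (hc : Continuous T)
    [OpensMeasurableSpace α] (hs : μ (frontier s) = 0) : μ (frontier (T ⁻¹' s)) = 0 :=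
  measure_mono_null (hc.frontier_preimage_subset s) (by
    rw [hT.measure_preimage isClosed_frontier.measurableSet.nullMeasurableSet, hs])

end NullFrontier

/-- Almost every level of a function is negligible. -/
theorem exists_measure_level_eq_zero {α : Type*} [MeasurableSpace α] {μ : Measure α}
    [SFinite μ] {f : α → ℝ} (hf : Measurable f) {a b : ℝ}
    (hab : a < b) : ∃ c ∈ Set.Ioo a b, μ {z | f z = c} = 0 := by
  have hcount := Measure.countable_meas_level_set_pos (μ := μ) hf
  obtain ⟨c, hc, h⟩ := (hcount.dense_compl ℝ).exists_between hab
  exact ⟨c, h, by simpa using hc⟩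

namespace DiagFlow

variable {d : ℕ} (A : DiagFlow d)

/-- For every `ψ` with compact support there is a finite partition with negligible boundary made of
one atom over the cusp, where `ψ` vanishes, and of atoms whose fibers are small compared with the
injectivity radius. -/
theorem exists_partition (hd : 0 < d) (μ : Measure (GridSpace d)) [IsProbabilityMeasure μ]
    {ψ : LatticeSpace d → ℝ} (hψ : HasCompactSupport ψ) :
    ∃ (n : ℕ) (P : Fin n → Set (GridSpace d)) (j₀ : Fin n) (P₀ : Set (LatticeSpace d)) (r : ℝ),
      IsPartition P ∧ P j₀ = proj ⁻¹' P₀ ∧ IsCompact (closure P₀ᶜ) ∧ (∀ z ∈ P₀, ψ z = 0) ∧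
      0 < r ∧ r < 1 / 2 ∧
      (∀ u ∈ A.Uplus, ∀ z ∉ P j₀, Metric.diam (A.qball u (3 * r)) < injRadius z) ∧
      (∀ j ≠ j₀, ∀ z ∈ P j, ∀ z' ∈ P j, proj z = proj z' → fiberDist z z' < r) ∧
      ∀ j, μ (frontier (P j)) = 0 := by
  obtain ⟨φ, hφ1, -, hφc, hφ⟩ := exists_continuous_one_zero_of_isCompact hψ.isCompact isClosed_empty
    (Set.disjoint_empty _)
  have hφπ : Continuous fun z : GridSpace d => φ (proj z) := φ.continuous.comp continuous_proj
  obtain ⟨c, hc, hcμ⟩ := exists_measure_level_eq_zero (μ := μ) hφπ.measurable zero_lt_one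
  obtain ⟨ρ, hρ, hinj⟩ := exists_le_injRadius hd hφc.isCompact
  obtain ⟨r, hr0, hr1, hr⟩ := A.exists_diam_qball_lt hρ
  -- small neighborhoods with negligible boundary
  have hV (z : GridSpace d) : ∃ V : Set (GridSpace d), IsOpen V ∧ z ∈ V ∧ μ (frontier V) = 0 ∧
      ∀ z₁ ∈ V, ∀ z₂ ∈ V, proj z₁ = proj z₂ → fiberDist z₁ z₂ < r := by
    obtain ⟨O, hO, hzO, hfib⟩ := exists_isOpen_fiberDist_lt z hr0
    obtain ⟨f, hf1, hf0, -, -⟩ := exists_continuous_one_zero_of_isCompact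
      (isCompact_singleton (x := z)) hO.isClosed_compl
      (Set.disjoint_compl_right_iff_subset.2 (by simpa using hzO))
    obtain ⟨b, hb, hbμ⟩ :=
      exists_measure_level_eq_zero (μ := μ) f.continuous.measurable zero_lt_one
    have hsub : {z | b < f z} ⊆ O := by
      intro z' hz'
      by_contra hnot
      have h0 : f z' = 0 := hf0 hnot
      have : b < f z' := hz'
      linarith [hb.1]
    refine ⟨{z | b < f z}, isOpen_lt continuous_const f.continuous, ?_, ?_, ?_⟩
    · have : f z = 1 := hf1 rfl
      simpa [this] using hb.2
    · refine measure_mono_null (frontier_lt_subset_eq continuous_const f.continuous) ?_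
      simpa [eq_comm] using hbμ
    · exact fun z₁ h₁ z₂ h₂ => hfib z₁ (hsub h₁) z₂ (hsub h₂)
  choose V hVo hVz hVμ hVfib using hV
  obtain ⟨t, -, ht⟩ := (isCompact_preimage_proj hφc.isCompact).elim_nhds_subcover V
    fun z _ => (hVo z).mem_nhds (hVz z)
  set e := t.equivFin
  set P₀ : Set (LatticeSpace d) := {x | φ x ≤ c}
  set W : Fin (t.card + 1) → Set (GridSpace d) :=
    Fin.cons (proj ⁻¹' P₀) fun j => V (e.symm j : GridSpace d)
  have hW0 : disjointed W 0 = proj ⁻¹' P₀ := by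
    rw [disjointed_of_isMin (f := W) (i := 0) fun j _ => Fin.zero_le j]
    rfl
  have hWm (j) : MeasurableSet (W j) := by
    refine Fin.cases ?_ (fun j => ?_) j
    · exact (isClosed_le φ.continuous continuous_const).measurableSet.preimage
        continuous_proj.measurable
    · exact (hVo _).measurableSet
  have hWμ (j) : μ (frontier (W j)) = 0 := by
    refine Fin.cases ?_ (fun j => ?_) j
    · exact measure_mono_null (frontier_le_subset_eq hφπ continuous_const) hcμ
    · exact hVμ _
  refine ⟨t.card + 1, disjointed W, 0, P₀, r, ⟨?_, ?_, ?_⟩, hW0, ?_, ?_, hr0, hr1, ?_, ?_,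
    measure_frontier_disjointed hWμ⟩
  · exact fun j => (hWm j).diff (Finset.sup_induction MeasurableSet.empty
      (fun s hs t ht => hs.union ht) fun i _ => hWm i)
  · exact disjoint_disjointed W
  · rw [iUnion_disjointed, Set.eq_univ_iff_forall]
    intro z
    by_cases hz : φ (proj z) ≤ c
    · exact Set.mem_iUnion.2 ⟨0, hz⟩
    · have hz' : z ∈ proj ⁻¹' tsupport φ := subset_tsupport _ fun h0 => hz (h0.trans_le hc.1.le)
      obtain ⟨z₁, hz₁, hmem⟩ := Set.mem_iUnion₂.1 (ht hz')
      refine Set.mem_iUnion.2 ⟨(e ⟨z₁, hz₁⟩).succ, ?_⟩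
      simpa [W] using hmem
  · refine hφc.isCompact.of_isClosed_subset isClosed_closure
      (closure_minimal (fun x hx => ?_) (isClosed_tsupport _))
    exact subset_tsupport _ fun h0 => hx (h0.trans_le hc.1.le)
  · intro x hx
    by_contra hne
    have h1 : φ x = 1 := hφ1 (subset_tsupport _ hne)
    have h2 : φ x ≤ c := hx
    linarith [hc.2]
  · intro u _ z hz
    rw [hW0] at hz
    exact (hr u).trans_le (hinj z (subset_tsupport _ fun h0 => hz (h0.trans_le hc.1.le)))
  · intro j hj z hz z' hz' h
    obtain ⟨j, rfl⟩ := Fin.exists_succ_eq.2 hj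
    exact hVfib _ z (disjointed_subset W _ hz) z' (disjointed_subset W _ hz') h

/-! ### The entropy of partitions adapted to the cusp -/

theorem measurableSet_joinIter {ι : Type*} {P : ι → Set (GridSpace d)}
    (hP : ∀ j, MeasurableSet (P j)) {q : ℕ} (w : Fin q → ι) :
    MeasurableSet (joinIter (A.flowY 1) P q w) :=
  MeasurableSet.iInter fun k =>
    (hP _).preimage ((A.continuous_flowY 1).measurable.iterate k)

/-- The entropy of the words of length `q` read from time `n` on, in terms of the masses that the
uniform measure on the points `a^n (y + u)` gives to the atoms of the refined partition. -/
theorem shannon_word_eq {m : ℕ} {P : Fin m → Set (GridSpace d)} (y : GridSpace d)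
    (F : Finset (E d)) {label : GridSpace d → Fin m} (hlabel : ∀ z j, label z = j ↔ z ∈ P j)
    (n q : ℕ) : shannon F (word (fun k u => label (A.flowY k (y.translate u))) n q) =
      ∑ w : Fin q → Fin m, Real.negMulLog
        (A.fiberMean y F ((joinIter (A.flowY 1) P q w).indicator fun _ => 1) n) := by
  classical
  rw [shannon_eq_sum]
  refine Finset.sum_congr rfl fun w _ => ?_
  congr 1
  rw [fiberMean, div_eq_inv_mul, Finset.card_filter]
  push_cast
  congr 1
  refine Finset.sum_congr rfl fun u _ => ?_
  have : word (fun k u => label (A.flowY k (y.translate u))) n q u = w ↔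
      A.flowY n (y.translate u) ∈ joinIter (A.flowY 1) P q w := by
    rw [funext_iff, joinIter, Set.mem_iInter]
    refine forall_congr' fun k => ?_
    rw [word, hlabel, Set.mem_preimage, ← A.iterate_flowY n, ← Function.iterate_add_apply,
      ← iterate_flowY, add_comm n]
  by_cases h : A.flowY n (y.translate u) ∈ joinIter (A.flowY 1) P q w
  · simp [h, this.2 h]
  · simp [h, mt this.1 h]

/-- An atom of the partition refined up to time `N` contains few points of a separated set. -/
theorem fiberCard_word_le {m : ℕ} {P : Fin m → Set (GridSpace d)} {j₀ : Fin m}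
    {P₀ : Set (LatticeSpace d)} (hP₀ : P j₀ = proj ⁻¹' P₀) {r : ℝ} (hr0 : 0 < r) (hr1 : r < 1 / 2)
    (hdiam : ∀ u ∈ A.Uplus, ∀ z ∉ P j₀, Metric.diam (A.qball u (3 * r)) < injRadius z)
    (hfib : ∀ j ≠ j₀, ∀ z ∈ P j, ∀ z' ∈ P j, proj z = proj z' → fiberDist z z' < r)
    {label : GridSpace d → Fin m} (hlabel : ∀ z j, label z = j ↔ z ∈ P j) (y : GridSpace d)
    {F : Finset (E d)} {R : ℝ} (hFU : ∀ u ∈ F, u ∈ A.Uplus) (hFR : ∀ u ∈ F, ‖u‖ < R) {N : ℕ}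
    (hsep : ∀ u ∈ F, ∀ v ∈ F, u ≠ v → Real.exp (-N) ≤ A.qdist u v)
    [DecidablePred fun n => (A.flowX 1)^[n] (proj y) ∈ P₀] (u₀ : E d) :
    fiberCard F (word (fun k u => label (A.flowY k (y.translate u))) 0 N) u₀ ≤
      (∏ j ∈ A.pos, (⌊2 * R / (3 * r) ^ A.c j⌋₊ + 1)) * 3 ^ (d * (((Finset.range N).filter
        fun n => (A.flowX 1)^[n] (proj y) ∈ P₀).card + 1)) := by
  refine A.card_le_of_norm_lt (by positivity : 0 < 3 * r)
    (fun u hu => by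
      simp only [Finset.mem_filter] at hu
      exact hFR u hu.1) _ fun G hG hGs => ?_
  have hGF (u) (hu : u ∈ G) : u ∈ F := by
    have := hG hu
    simp only [Finset.mem_filter] at this
    exact this.1
  have hGw (u) (hu : u ∈ G) : word (fun k u => label (A.flowY k (y.translate u))) 0 N u =
      word (fun k u => label (A.flowY k (y.translate u))) 0 N u₀ := by
    have := hG hu
    simp only [Finset.mem_filter] at this
    exact this.2
  have hnot (n) (hn : (A.flowX 1)^[n] (proj y) ∉ P₀) (u : E d) :
      A.flowY n (y.translate u) ∉ P j₀ := by
    rw [hP₀, Set.mem_preimage, proj_flowY_translate]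
    exact hn
  rw [Finset.range_eq_Ico]
  refine A.card_le_of_itinerary hr0 hr1 y (fun n => (A.flowX 1)^[n] (proj y) ∈ P₀) N N 0 G
    (zero_add N) (fun u hu => hFU u (hGF u hu)) ?_ ?_ ?_ ?_
  · exact fun n _ hn u _ p hp => hdiam p hp _ (hnot n hn u)
  · intro n hnN hn u hu v hv
    have hw := word_eq_iff.1 ((hGw u hu).trans (hGw v hv).symm) n (Nat.zero_le _) (by omega)
    have hv' := (hlabel _ _).1 hw.symm
    have hu' := (hlabel _ _).1 (rfl : label (A.flowY n (y.translate u)) = _)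
    refine hfib _ ?_ _ hu' _ hv' (by rw [proj_flowY_translate, proj_flowY_translate])
    intro hj
    rw [hj] at hu'
    exact hnot n hn u hu'
  · exact fun u hu v hv => hsep u (hGF u hu) v (hGF v hv)
  · simpa using hGs

theorem log_mul_three_pow {C : ℕ} (hC : 0 < C) (b : ℕ) :
    Real.log ((C * 3 ^ (d * (b + 1)) : ℕ) : ℝ) = Real.log C + d * Real.log 3 * (b + 1) := by
  have hC' : (C : ℝ) ≠ 0 := by exact_mod_cast hC.ne'
  push_cast
  rw [Real.log_mul hC' (by positivity), Real.log_pow]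
  push_cast
  ring

section LowerBound

variable {y : GridSpace d} {F : ℕ → Finset (E d)} {T : ℕ → ℕ}
  {μ₀ : ProbabilityMeasure (LatticeSpace d)}
  {hF : ∀ k, (F k).Nonempty} {hT1 : ∀ k, 1 ≤ T k} {μ : ProbabilityMeasure (GridSpace d)}

/-- The entropy of an adapted partition for the limit of the orbit measures of separated sets of
exponential growth rate at least `c`. -/
theorem mul_sub_le_sum_integral (hT : StrictMono T)
    (hlim : ∀ f : C₀(LatticeSpace d, ℝ),
      Tendsto (fun k => (1 / (T k : ℝ)) * ∑ i ∈ Finset.range (T k), f ((A.flowX 1)^[i] (proj y)))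
        atTop (𝓝 (∫ z, f z ∂(μ₀ : Measure (LatticeSpace d)))))
    (hμ : Tendsto (A.orbitProb y hF hT1) (hyperfilter ℕ) (𝓝 μ))
    {R : ℝ} (hFU : ∀ k, ∀ u ∈ F k, u ∈ A.Uplus) (hFR : ∀ k, ∀ u ∈ F k, ‖u‖ < R)
    (hsep : ∀ k, ∀ u ∈ F k, ∀ v ∈ F k, u ≠ v → Real.exp (-T k) ≤ A.qdist u v)
    {c : ℝ} (hc : ∀ᶠ k in (hyperfilter ℕ : Filter ℕ), c * T k < Real.log (F k).card)
    {ψ : LatticeSpace d → ℝ} (hψ : Continuous ψ) (hψc : HasCompactSupport ψ)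
    (hψ1 : ∀ x, ψ x ≤ 1) {η : ℝ} (hη : 1 - η ≤ ∫ x, ψ x ∂(μ₀ : Measure (LatticeSpace d)))
    {m : ℕ} {P : Fin m → Set (GridSpace d)} (hP : IsPartition P) {j₀ : Fin m}
    {P₀ : Set (LatticeSpace d)} (hP₀ : P j₀ = proj ⁻¹' P₀) (hψ0 : ∀ z ∈ P₀, ψ z = 0)
    {r : ℝ} (hr0 : 0 < r) (hr1 : r < 1 / 2)
    (hdiam : ∀ u ∈ A.Uplus, ∀ z ∉ P j₀, Metric.diam (A.qball u (3 * r)) < injRadius z)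
    (hfib : ∀ j ≠ j₀, ∀ z ∈ P j, ∀ z' ∈ P j, proj z = proj z' → fiberDist z z' < r)
    (hfr : ∀ j, (μ : Measure (GridSpace d)) (frontier (P j)) = 0) {q : ℕ} (hq : 1 ≤ q) :
    q * (c - d * Real.log 3 * η) ≤ ∑ w : Fin q → Fin m, ∫ z, Real.negMulLog
      (condProb (μ : Measure (GridSpace d)) (joinIter (A.flowY 1) P q w) z)
        ∂(μ : Measure (GridSpace d)) := by
  classical
  have hex (z : GridSpace d) : ∃ j, z ∈ P j := by
    have : z ∈ ⋃ j, P j := hP.cover ▸ trivial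
    simpa using this
  choose label hlab using hex
  have hlabel (z j) : label z = j ↔ z ∈ P j := by
    constructor
    · rintro rfl
      exact hlab z
    · intro hz
      by_contra hne
      exact Set.disjoint_left.1 (hP.disjoint hne) (hlab z) hz
  set D : ℝ := d * Real.log 3
  have hD : 0 ≤ D := mul_nonneg (by positivity) (Real.log_nonneg (by norm_num))
  set C : ℕ := ∏ j ∈ A.pos, (⌊2 * R / (3 * r) ^ A.c j⌋₊ + 1)
  have hC : 0 < C := Finset.prod_pos fun _ _ => Nat.succ_pos _
  set K : ℝ := ∑ s ∈ Finset.range q, (Fintype.card (Fin s → Fin m) : ℝ)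
  set I : ℝ := ∑ w : Fin q → Fin m, ∫ z, Real.negMulLog
    (condProb (μ : Measure (GridSpace d)) (joinIter (A.flowY 1) P q w) z)
      ∂(μ : Measure (GridSpace d))
  set Z : ℝ := (Fintype.card (Fin q → Fin m) : ℝ)
  have hmp := A.measurePreserving_of_tendsto hT hμ
  have hq0 : (0 : ℝ) < q := by exact_mod_cast hq
  have hfrw (w : Fin q → Fin m) :
      (μ : Measure (GridSpace d)) (frontier (joinIter (A.flowY 1) P q w)) = 0 :=
    measure_frontier_iInter fun k => measure_frontier_preimage (hmp.iterate k)
      ((A.continuous_flowY 1).iterate k) (hfr _)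
  -- it is enough to bound the defect by arbitrarily small numbers
  suffices ∀ ε > 0, q * (c - D * η) ≤ I + ε * (Z + q * D + q) by
    refine le_of_forall_pos_le_add fun ε hε => ?_
    have hpos : 0 < Z + q * D + q := by positivity
    have := this (ε / (Z + q * D + q)) (by positivity)
    rwa [div_mul_cancel₀ _ hpos.ne'] at this
  intro ε hε
  have h1 : ∀ᶠ k in (hyperfilter ℕ : Filter ℕ), ∀ w : Fin q → Fin m,
      (T k : ℝ)⁻¹ * ∑ n ∈ Finset.range (T k), Real.negMulLog (A.fiberMean y (F k)
        ((joinIter (A.flowY 1) P q w).indicator fun _ => 1) n) ≤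
        ∫ z, Real.negMulLog (condProb (μ : Measure (GridSpace d))
          (joinIter (A.flowY 1) P q w) z) ∂(μ : Measure (GridSpace d)) + ε :=
    eventually_all.2 fun w => A.eventually_avg_negMulLog_le hμ
      (A.measurableSet_joinIter hP.measurableSet w) (hfrw w) hε
  have h2 := ((A.tendsto_of_hasCompactSupport hlim hψ hψc).mono_left
    Nat.hyperfilter_le_atTop).eventually_const_lt (sub_lt_self _ hε)
  have h3 := (tendsto_div_atTop_hyperfilter hT (Real.log C + D + K)).eventually_lt_const hε
  obtain ⟨k, hk, hk1, hk2, hk3⟩ := (hc.and (h1.and (h2.and h3))).exists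
  have hTk : (0 : ℝ) < T k := by exact_mod_cast hT1 k
  set lab : ℕ → E d → Fin m := fun n u => label (A.flowY n (y.translate u))
  set b : ℕ := ((Finset.range (T k)).filter fun n => (A.flowX 1)^[n] (proj y) ∈ P₀).card
  -- the orbit rarely visits the cusp
  have hb : (b : ℝ) ≤ (η + ε) * T k := by
    have hsum : (b : ℝ) + ∑ n ∈ Finset.range (T k), ψ ((A.flowX 1)^[n] (proj y)) ≤ T k := by
      have : (b : ℝ) = ∑ n ∈ Finset.range (T k),
          if (A.flowX 1)^[n] (proj y) ∈ P₀ then (1 : ℝ) else 0 := by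
        simp [b]
      rw [this, ← Finset.sum_add_distrib]
      refine (Finset.sum_le_card_nsmul _ _ 1 fun n _ => ?_).trans (by simp)
      split_ifs with h
      · rw [hψ0 _ h, add_zero]
      · rw [zero_add]
        exact hψ1 _
    have h4 : (1 - η - ε) * T k < ∑ n ∈ Finset.range (T k), ψ ((A.flowX 1)^[n] (proj y)) := by
      rw [one_div, ← div_eq_inv_mul, lt_div_iff₀ hTk] at hk2
      refine lt_of_le_of_lt ?_ hk2
      gcongr
    linarith
  have hlow : Real.log (F k).card - (Real.log C + D * (b + 1)) ≤
      shannon (F k) (word lab 0 (T k)) := by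
    rw [← log_mul_three_pow hC]
    exact le_shannon (hF k) fun u _ => A.fiberCard_word_le hP₀ hr0 hr1 hdiam hfib hlabel y
      (hFU k) (hFR k) (hsep k) u
  have hup := mul_shannon_word_le (F k) lab hq (T k)
  have hsum : ∑ n ∈ Finset.range (T k), shannon (F k) (word lab n q) ≤ T k * (I + Z * ε) := by
    simp only [lab, A.shannon_word_eq y (F k) hlabel]
    rw [Finset.sum_comm]
    have h5 : ∀ w ∈ (Finset.univ : Finset (Fin q → Fin m)), ∑ n ∈ Finset.range (T k),
        Real.negMulLog (A.fiberMean y (F k)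
          ((joinIter (A.flowY 1) P q w).indicator fun _ => 1) n) ≤
        T k * (∫ z, Real.negMulLog (condProb (μ : Measure (GridSpace d))
          (joinIter (A.flowY 1) P q w) z) ∂(μ : Measure (GridSpace d)) + ε) := by
      intro w _
      have := hk1 w
      rwa [inv_mul_le_iff₀ hTk] at this
    refine (Finset.sum_le_sum h5).trans (le_of_eq ?_)
    rw [← Finset.mul_sum, Finset.sum_add_distrib, Finset.sum_const, nsmul_eq_mul, Finset.card_univ]
  rw [div_lt_iff₀ hTk] at hk3
  have h6 : q * (c * T k - (Real.log C + D * (b + 1))) ≤ T k * (I + Z * ε) + q * K := by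
    have := mul_le_mul_of_nonneg_left hlow hq0.le
    have h7 : q * (c * T k - (Real.log C + D * (b + 1))) ≤
        q * (Real.log (F k).card - (Real.log C + D * (b + 1))) := by
      gcongr
    linarith
  have h8 : D * b ≤ D * ((η + ε) * T k) := mul_le_mul_of_nonneg_left hb hD
  have h9 : q * (c * T k - D * ((η + ε) * T k) - ε * T k) ≤ T k * (I + Z * ε) := by
    have : q * (c * T k - D * ((η + ε) * T k) - ε * T k) ≤
        q * (c * T k - D * b - (Real.log C + D + K)) := by
      gcongr
    linarith
  refine le_of_mul_le_mul_left ?_ hTk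
  linarith

end LowerBound

end DiagFlow

/-! ### Finite partitions as countable partitions -/

section Extend

variable {d n : ℕ}

/-- A finite partition, completed by empty atoms to a countable partition. -/
def extendPartition (P : Fin n → Set (GridSpace d)) (k : ℕ) : Set (GridSpace d) :=
  if h : k < n then P ⟨k, h⟩ else ∅

@[simp] theorem extendPartition_val (P : Fin n → Set (GridSpace d)) (j : Fin n) :
    extendPartition P j = P j := by
  simp [extendPartition]

theorem extendPartition_of_le (P : Fin n → Set (GridSpace d)) {k : ℕ} (h : n ≤ k) :
    extendPartition P k = ∅ := by
  simp [extendPartition, not_lt.2 h]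

theorem isPartition_extendPartition {P : Fin n → Set (GridSpace d)} (hP : IsPartition P) :
    IsPartition (extendPartition P) where
  measurableSet k := by
    rw [extendPartition]
    split_ifs
    exacts [hP.measurableSet _, MeasurableSet.empty]
  disjoint k l hkl := by
    simp only [extendPartition]
    split_ifs with h1 h2
    · exact hP.disjoint fun h => hkl (by simpa using h)
    all_goals simp
  cover := by
    rw [Set.eq_univ_iff_forall]
    intro z
    have : z ∈ ⋃ j, P j := hP.cover ▸ trivial
    obtain ⟨j, hj⟩ := Set.mem_iUnion.1 this
    exact Set.mem_iUnion.2 ⟨j, by simpa using hj⟩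

theorem relEntropy_extendPartition_lt_top (μ : Measure (GridSpace d)) [IsProbabilityMeasure μ]
    {P : Fin n → Set (GridSpace d)} (hP : IsPartition P) :
    relEntropy (fiberAlgebra d) μ (extendPartition P) < ∞ := by
  rw [relEntropy, tsum_eq_sum (s := Finset.range n)]
  · refine ENNReal.sum_lt_top.2 fun k _ => ?_
    exact (integrable_negMulLog_condProb μ
      ((isPartition_extendPartition hP).measurableSet k)).lintegral_lt_top
  · intro k hk
    rw [extendPartition_of_le P (by simpa using hk), Set.indicator_empty]
    have : μ[(fun _ => 0 : GridSpace d → ℝ) | fiberAlgebra d] = 0 := condExp_zero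
    rw [this]
    simp

theorem relEntropy_joinIter_le (μ : Measure (GridSpace d)) (T : GridSpace d → GridSpace d)
    (P : Fin n → Set (GridSpace d)) (q : ℕ) :
    relEntropy (fiberAlgebra d) μ (joinIter T P q) ≤
      relEntropy (fiberAlgebra d) μ (joinIter T (extendPartition P) q) := by
  have hinj : Function.Injective fun (w : Fin q → Fin n) (k : Fin q) => (w k : ℕ) := by
    intro w w' h
    ext k
    exact congrFun h k
  have hjoin (w : Fin q → Fin n) :
      joinIter T (extendPartition P) q (fun k => (w k : ℕ)) = joinIter T P q w := by
    simp [joinIter]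
  rw [relEntropy, relEntropy]
  simp_rw [← hjoin]
  exact ENNReal.tsum_comp_le_tsum_of_injective hinj (fun w => ∫⁻ z, ENNReal.ofReal
    (Real.negMulLog ((μ[(joinIter T (extendPartition P) q w).indicator (fun _ => (1 : ℝ)) |
      fiberAlgebra d]) z)) ∂μ)

end Extend

/-! ### Conclusion -/

namespace DiagFlow

variable {d : ℕ} (A : DiagFlow d)

/-- The entropies of the partitions adapted to the cusp approach the dimension when the cusp
excursions become negligible. -/
theorem le_relDynEntropy (hd : 0 < d) {μ : Measure (GridSpace d)} [IsProbabilityMeasure μ]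
    {ψ : ℕ → LatticeSpace d → ℝ} (hψ : ∀ i, HasCompactSupport (ψ i)) {η : ℕ → ℝ}
    (hη : Tendsto η atTop (𝓝 0)) {D : ℝ} {δ : EReal}
    (key : ∀ (n : ℕ) (P : Fin n → Set (GridSpace d)), IsPartition P →
      ∀ (j₀ : Fin n) (i : ℕ) (P₀ : Set (LatticeSpace d)), P j₀ = proj ⁻¹' P₀ →
      IsCompact (closure P₀ᶜ) → (∀ z ∈ P₀, ψ i z = 0) →
      ∀ r : ℝ, 0 < r → r < 1 / 2 →
      (∀ u ∈ A.Uplus, ∀ z ∉ P j₀, Metric.diam (A.qball u (3 * r)) < injRadius z) →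
      (∀ j ≠ j₀, ∀ z ∈ P j, ∀ z' ∈ P j, proj z = proj z' → fiberDist z z' < r) →
      (∀ j, μ (frontier (P j)) = 0) → ∀ q : ℕ, 1 ≤ q →
        δ - ((D * η i : ℝ) : EReal) ≤
          ((relEntropy (fiberAlgebra d) μ (joinIter (A.flowY 1) P q) / (q : ℝ≥0∞) : ℝ≥0∞) :
            EReal)) :
    δ ≤ ((relDynEntropy (fiberAlgebra d) μ (A.flowY 1) : ℝ≥0∞) : EReal) := by
  have hstep (i : ℕ) : δ - ((D * η i : ℝ) : EReal) ≤
      ((relDynEntropy (fiberAlgebra d) μ (A.flowY 1) : ℝ≥0∞) : EReal) := by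
    obtain ⟨n, P, j₀, P₀, r, hP, hP₀, hcomp, hψ0, hr0, hr1, hdiam, hfib, hfr⟩ :=
      A.exists_partition hd μ (hψ i)
    have hq := key n P hP j₀ i P₀ hP₀ hcomp hψ0 r hr0 hr1 hdiam hfib hfr
    have hsup : (⨅ q ∈ {q : ℕ | 1 ≤ q}, relEntropy (fiberAlgebra d) μ
        (joinIter (A.flowY 1) (extendPartition P) q) / (q : ℝ≥0∞)) ≤
        relDynEntropy (fiberAlgebra d) μ (A.flowY 1) :=
      le_iSup₂ (f := fun (P : ℕ → Set (GridSpace d))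
        (_ : P ∈ {P | IsPartition P ∧ relEntropy (fiberAlgebra d) μ P < ∞}) =>
        ⨅ q ∈ {q : ℕ | 1 ≤ q}, relEntropy (fiberAlgebra d) μ (joinIter (A.flowY 1) P q) /
          (q : ℝ≥0∞)) (extendPartition P)
        ⟨isPartition_extendPartition hP, relEntropy_extendPartition_lt_top μ hP⟩
    refine le_trans ?_ (EReal.coe_ennreal_le_coe_ennreal_iff.2 hsup)
    -- an extended real below all the terms is below the infimum
    rcases le_total (δ - ((D * η i : ℝ) : EReal)) 0 with hneg | hnonneg
    · exact hneg.trans (EReal.coe_ennreal_nonneg _)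
    · rw [← EReal.coe_toENNReal hnonneg, EReal.coe_ennreal_le_coe_ennreal_iff]
      refine le_iInf₂ fun q hq1 => ?_
      rw [← EReal.coe_ennreal_le_coe_ennreal_iff, EReal.coe_toENNReal hnonneg]
      refine (hq q hq1).trans (EReal.coe_ennreal_le_coe_ennreal_iff.2 ?_)
      gcongr
      exact relEntropy_joinIter_le μ _ P q
  rw [← EReal.ge_of_forall_gt_iff_ge]
  intro c hc
  have hlim : Tendsto (fun i => ((c - D * η i : ℝ) : EReal)) atTop (𝓝 (c : EReal)) := by
    rw [EReal.tendsto_coe]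
    simpa using (hη.const_mul D).const_sub c
  refine le_of_tendsto' hlim fun i => ?_
  rw [EReal.coe_sub]
  exact (EReal.sub_le_sub hc.le le_rfl).trans (hstep i)

/-- A subset of a leaf carries separated sets at all scales whose growth rate is its
dimension. -/
theorem exists_isSep_of_leaf {y : GridSpace d} {S : Set (GridSpace d)} (hS : S.Nonempty)
    (hSy : S ⊆ A.leaf y) :
    ∃ F : ℝ → Finset (E d), ∀ δ > 0, (F δ).Nonempty ∧
      IsSep A.qdist {u | u ∈ A.leafBall y ∧ y.translate u ∈ S} δ (F δ) ∧
      ∀ c : ℝ, (c : EReal) < A.dimA y S →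
        ∀ᶠ δ in 𝓝[>] (0 : ℝ), c * Real.log (1 / δ) < Real.log (F δ).card := by
  set S' := {u | u ∈ A.leafBall y ∧ y.translate u ∈ S}
  have hbound : ∀ u ∈ S', ‖u‖ < injRadius y := fun u hu => hu.1.2
  have hFex (δ : ℝ) (hδ : 0 < δ) : ∃ F, IsSep A.qdist S' δ F ∧ sepNumber A.qdist S' δ = F.card ∧
      ∀ T', IsSep A.qdist S' δ T' → T'.card ≤ F.card :=
    exists_isSep_card_eq (A.exists_card_le_of_isSep hbound hδ).choose_spec
  choose! F hF hFs hFmax using hFex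
  obtain ⟨z, hz⟩ := hS
  obtain ⟨u₀, hu₀, rfl⟩ := hSy hz
  have hF1 (δ : ℝ) (hδ : 0 < δ) : 1 ≤ (F δ).card := by
    have : IsSep A.qdist S' δ {u₀} := ⟨by simpa using ⟨hu₀, hz⟩, by simp⟩
    simpa using hFmax δ hδ _ this
  refine ⟨F, fun δ hδ => ⟨Finset.card_pos.1 (hF1 δ hδ), hF δ hδ, fun c hc => ?_⟩⟩
  rw [dimA, lowerMinkowskiDim_eq (N := fun δ => (F δ).card)
    fun δ hδ _ => ⟨hFs δ hδ, hF1 δ hδ⟩] at hc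
  filter_upwards [eventually_lt_of_lt_liminf hc, Ioo_mem_nhdsGT (zero_lt_one (α := ℝ))] with ε h1 hε
  rw [EReal.coe_lt_coe_iff, lt_div_iff₀] at h1
  · exact h1
  · exact Real.log_pos (by rw [lt_div_iff₀ hε.1]; linarith [hε.2])

end DiagFlow

end GridEntropy


end

open GridEntropy in
theorem mainTheorem6 (d : ℕ) (hd : 2 ≤ d) (A : DiagFlow d) :
    ∃ D : ℝ, ∀ (ψ : ℕ → LatticeSpace d → ℝ), IsExhaustion ψ →
      ∀ (η : ℕ → ℝ), (∀ i, 0 ≤ η i) → Tendsto η atTop (𝓝 0) →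
      ∀ (x : LatticeSpace d), x ∈ A.heavySet ψ η →
      ∀ (y : GridSpace d), proj y = x →
      ∀ (μ₀ : ProbabilityMeasure (LatticeSpace d)), μ₀ ∈ A.orbitLimits x ∩ tightClass ψ η →
      ∀ (S : Set (GridSpace d)), S.Nonempty → S ⊆ A.leaf y →
      ∃ μ : ProbabilityMeasure (GridSpace d),
        MeasurePreserving (A.flowY 1) (μ : Measure (GridSpace d)) (μ : Measure (GridSpace d)) ∧
        Measure.map proj (μ : Measure (GridSpace d)) = (μ₀ : Measure (LatticeSpace d)) ∧
        (μ : Measure (GridSpace d)).support ⊆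
          ⋂ (s : ℕ) (_ : 1 ≤ s), closure (⋃ (t : ℝ) (_ : (s : ℝ) ≤ t), A.flowY t '' S) ∧
        A.dimA y S ≤
          ((relDynEntropy (fiberAlgebra d) (μ : Measure (GridSpace d)) (A.flowY 1) : ℝ≥0∞) :
            EReal) ∧
        A.dimM y S + (A.h : EReal) - ((Module.finrank ℝ A.Uplus : ℝ) : EReal) ≤ A.dimA y S ∧
        ∀ (n : ℕ) (P : Fin n → Set (GridSpace d)), IsPartition P →
          ∀ (j₀ : Fin n) (i : ℕ) (P₀ : Set (LatticeSpace d)), P j₀ = proj ⁻¹' P₀ →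
          IsCompact (closure P₀ᶜ) → (∀ z ∈ P₀, ψ i z = 0) →
          ∀ r : ℝ, 0 < r → r < 1 / 2 →
          (∀ u ∈ A.Uplus, ∀ z ∉ P j₀, Metric.diam (A.qball u (3 * r)) < injRadius z) →
          (∀ j ≠ j₀, ∀ z ∈ P j, ∀ z' ∈ P j, proj z = proj z' → fiberDist z z' < r) →
          (∀ j, (μ : Measure (GridSpace d)) (frontier (P j)) = 0) →
          ∀ q : ℕ, 1 ≤ q →
            A.dimA y S - ((D * η i : ℝ) : EReal) ≤
              ((relEntropy (fiberAlgebra d) (μ : Measure (GridSpace d))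
                (joinIter (A.flowY 1) P q) / (q : ℝ≥0∞) : ℝ≥0∞) : EReal) := by
  have hd0 : 0 < d := by omega
  refine ⟨d * Real.log 3, fun ψ hψ η _ hη x _ y hyx μ₀ hμ₀ S hS hSy => ?_⟩
  subst hyx
  obtain ⟨⟨T₀, hT₀, hlim₀⟩, htight⟩ := hμ₀
  -- the first time is discarded, as it may vanish
  set T : ℕ → ℕ := fun k => T₀ (k + 1)
  have hT : StrictMono T := fun a b hab => hT₀ (Nat.succ_lt_succ hab)
  have hT1 (k) : 1 ≤ T k := Nat.one_le_iff_ne_zero.2 (Nat.ne_zero_of_lt (hT₀ (Nat.succ_pos k)))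
  have hlim (f : C₀(LatticeSpace d, ℝ)) := (hlim₀ f).comp (tendsto_add_atTop_nat 1)
  obtain ⟨F₀, hF₀⟩ := A.exists_isSep_of_leaf hS hSy
  set F : ℕ → Finset (E d) := fun k => F₀ (Real.exp (-T k))
  have hF (k) : (F k).Nonempty := (hF₀ _ (Real.exp_pos _)).1
  have hsep (k) := (hF₀ _ (Real.exp_pos (-T k))).2.1
  obtain ⟨μ, hμ⟩ := A.exists_tendsto_orbitProb hT hF hT1 hlim
  have key : ∀ (n : ℕ) (P : Fin n → Set (GridSpace d)), IsPartition P →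
      ∀ (j₀ : Fin n) (i : ℕ) (P₀ : Set (LatticeSpace d)), P j₀ = proj ⁻¹' P₀ →
      IsCompact (closure P₀ᶜ) → (∀ z ∈ P₀, ψ i z = 0) →
      ∀ r : ℝ, 0 < r → r < 1 / 2 →
      (∀ u ∈ A.Uplus, ∀ z ∉ P j₀, Metric.diam (A.qball u (3 * r)) < injRadius z) →
      (∀ j ≠ j₀, ∀ z ∈ P j, ∀ z' ∈ P j, proj z = proj z' → fiberDist z z' < r) →
      (∀ j, (μ : Measure (GridSpace d)) (frontier (P j)) = 0) →
      ∀ q : ℕ, 1 ≤ q →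
        A.dimA y S - ((d * Real.log 3 * η i : ℝ) : EReal) ≤
          ((relEntropy (fiberAlgebra d) (μ : Measure (GridSpace d))
            (joinIter (A.flowY 1) P q) / (q : ℝ≥0∞) : ℝ≥0∞) : EReal) := by
    intro n P hP j₀ i P₀ hP₀ _ hψ0 r hr0 hr1 hdiam hfib hfr q hq
    have hq0 : (0 : ℝ) < q := by exact_mod_cast hq
    rw [relEntropy_eq_ofReal _ (A.measurableSet_joinIter hP.measurableSet),
      ← ENNReal.ofReal_natCast, ← ENNReal.ofReal_div_of_pos hq0, EReal.coe_ennreal_ofReal]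
    refine EReal.sub_le_of_le_add (EReal.ge_of_forall_gt_iff_ge.1 fun c hc => ?_)
    have hgrowth : ∀ᶠ k in (hyperfilter ℕ : Filter ℕ), c * T k < Real.log (F k).card := by
      have hexp : Tendsto (fun k => Real.exp (-(T k : ℝ))) atTop (𝓝[>] 0) :=
        tendsto_nhdsWithin_iff.2 ⟨Real.tendsto_exp_neg_atTop_nhds_zero.comp
          (tendsto_natCast_atTop_atTop.comp hT.tendsto_atTop),
          Eventually.of_forall fun k => Real.exp_pos _⟩
      filter_upwards [Nat.hyperfilter_le_atTop
        (hexp.eventually ((hF₀ 1 one_pos).2.2 c hc))] with k hk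
      rwa [one_div, Real.log_inv, Real.log_exp, neg_neg] at hk
    have hmain := A.mul_sub_le_sum_integral hT hlim hμ (R := injRadius y)
      (fun k u hu => ((hsep k).1 hu).1.1) (fun k u hu => ((hsep k).1 hu).1.2)
      (fun k => (hsep k).2) hgrowth (hψ.continuous i) (hψ.hasCompactSupport i) (hψ.le_one i)
      (htight i) hP hP₀ hψ0 hr0 hr1 hdiam hfib hfr hq
    rw [← EReal.coe_add, EReal.coe_le_coe_iff]
    rw [mul_comm, ← le_div_iff₀ hq0] at hmain
    exact sub_le_iff_le_add.1 (hmain.trans (le_max_left _ _))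
  refine ⟨μ, A.measurePreserving_of_tendsto hT hμ, A.map_proj_of_tendsto hlim hμ, ?_,
    A.le_relDynEntropy hd0 hψ.hasCompactSupport hη key, ?_, key⟩
  · exact Set.subset_iInter₂ fun s _ =>
      A.support_subset_of_tendsto hT (fun k u hu => ((hsep k).1 hu).2) hμ s
  · obtain ⟨z, hz⟩ := hS
    obtain ⟨u₀, hu₀, rfl⟩ := hSy hz
    exact A.lowerMinkowskiDim_dist_le hd0 ⟨u₀, hu₀, hz⟩ (fun u hu => hu.1.1) (fun u hu => hu.1.2)
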